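/- All graphs are finite, undirected and simple. A connected graph $\Gamma$ of diameter $D$ is *distance-regular* if there are integers $b_i,c_i$ $(0\le i\le D)$ such that for any two vertices $x,y$ at distance $i$ there are exactly $c_i$ neighbours of $y$ at distance $i-1$ from $x$ and exactly $b_i$ neighbours of $y$ at distance $i+1$ from $x$ (so $c_0=b_D=0$). A *Terwilliger graph* is a connected non-complete graph for which there is a fixed $\mu\ge 1$ such that for any two vertices $u,v$ at distance two the common neighbours of $u$ and $v$ form a clique of size $\mu$. The eigenvalues of a graph are those of its adjacency matrix, and its second largest eigenvalue is the second largest of its distinct eigenvalues. Let $T\ge 1$ be a real number. Then, up to isomorphism, there are only finitely many distance-regular Terwilliger graphs with $c_2\ge 2$ and second largest eigenvalue at least $\frac{b_1}{T}-1$. -/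

import Mathlib

namespace DRG

/-- `G` is a distance-regular graph with intersection numbers `b i`, `c i`: it is connected, and
for all vertices `x`, `y` at distance `i` there are exactly `b i` neighbours of `y` at distance
`i + 1` from `x`, and exactly `c i` neighbours of `y` at distance `i - 1` from `x` (none if
`i = 0`). Only the values `b i`, `c i` with `i` at most the diameter are constrained; `c 0 = 0`
and `b i = 0` for `i` the diameter are forced. -/
def IsDistanceRegularWith {V : Type*} (G : SimpleGraph V) (b c : ℕ → ℕ) : Prop :=
  G.Connected ∧ ∀ x y : V,
    {z | G.Adj y z ∧ G.dist x z = G.dist x y + 1}.ncard = b (G.dist x y) ∧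
    {z | G.Adj y z ∧ G.dist x z + 1 = G.dist x y}.ncard = c (G.dist x y)

/-- A Terwilliger graph: connected, not complete, and for some fixed `μ ≥ 1` the common neighbours
of any two vertices at distance two form a clique of size `μ`. -/
def IsTerwilliger {V : Type*} (G : SimpleGraph V) : Prop :=
  G.Connected ∧ G ≠ ⊤ ∧ ∃ μ : ℕ, 1 ≤ μ ∧ ∀ u v : V, G.dist u v = 2 →
    G.IsClique (G.commonNeighbors u v) ∧ (G.commonNeighbors u v).ncard = μ

open Classical in
/-- `θ` is an eigenvalue of `G`, i.e. of its real adjacency matrix. -/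
def IsEigenvalue {V : Type*} [Fintype V] (G : SimpleGraph V) (θ : ℝ) : Prop :=
  Module.End.HasEigenvalue (Matrix.toLin' (G.adjMatrix ℝ)) θ

/-- `θ` is the second largest among the distinct eigenvalues of `G`: the largest of those
eigenvalues that are smaller than some other eigenvalue. -/
def IsSecondLargestEigenvalue {V : Type*} [Fintype V] (G : SimpleGraph V) (θ : ℝ) : Prop :=
  IsGreatest {t : ℝ | IsEigenvalue G t ∧ ∃ s : ℝ, IsEigenvalue G s ∧ t < s} θ

end DRG

/-!
The diameter is bounded in terms of the valency `b 0`. If `c 2 ≥ 2`, then `b` and `c` cannot both be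
constant on an interval `[i, 3 * i]`: constancy would propagate down to `[1, 3]`, whereas `c 1 = 1`.
So `c j - b j` increases whenever `j` triples, while it stays between `-b 0` and `b 0`.

The valency is bounded in terms of `T`. For an eigenvalue `θ < b 0`, some polynomial in the
adjacency matrix is positive semidefinite and has entries `e (dist u v)`, where `e 0 > e 1` and
`b 1 * (e 1 - e 2) = (θ + 1) * (e 0 - e 1)`. Restricted to the local graph `Δ` of a vertex, it shows
that all eigenvalues of `Δ` are at least `-(1 + T)` as soon as `θ ≥ b 1 / T - 1`. Now `Δ` is
regular, and any two nonadjacent vertices of `Δ` have the same positive number of common neighbours,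
which form a clique. If such a graph `Δ` is large but not complete, then it contains two large
cliques without edges between them that are completely joined to a third large clique, and this
forces a smaller eigenvalue.
-/

open Finset SimpleGraph

namespace DRG

theorem exists_mem_notMem_of_ncard_le {α : Type*} [Finite α] {s t : Set α} {a : α}
    (hcard : s.ncard ≤ t.ncard) (hs : a ∈ s) (ht : a ∉ t) : ∃ b ∈ t, b ∉ s := by
  by_contra! hsub
  exact ht (Set.eq_of_subset_of_ncard_le hsub hcard ▸ hs)

section DiameterBound

variable {V : Type*} {G : SimpleGraph V} {b c : ℕ → ℕ} {x x' y z : V}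

/-- The neighbours of `y` that are closer to `x` than `y` is: the set `C(x, y)` of the literature,
of size `c i` for `x`, `y` at distance `i`. -/
def nearer (G : SimpleGraph V) (x y : V) : Set V :=
  {z | G.Adj y z ∧ G.dist x z + 1 = G.dist x y}

/-- The neighbours of `y` that are farther from `x` than `y` is: the set `B(x, y)` of the
literature, of size `b i` for `x`, `y` at distance `i`. -/
def farther (G : SimpleGraph V) (x y : V) : Set V :=
  {z | G.Adj y z ∧ G.dist x z = G.dist x y + 1}

theorem IsDistanceRegularWith.ncard_nearer (hG : IsDistanceRegularWith G b c) (x y : V) :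
    (nearer G x y).ncard = c (G.dist x y) := (hG.2 x y).2

theorem IsDistanceRegularWith.ncard_farther (hG : IsDistanceRegularWith G b c) (x y : V) :
    (farther G x y).ncard = b (G.dist x y) := (hG.2 x y).1

theorem ncard_neighborSet (hG : IsDistanceRegularWith G b c) (x : V) :
    (G.neighborSet x).ncard = b 0 := by
  rw [← G.dist_self (v := x), ← hG.ncard_farther]
  congr 1
  ext z
  simp [farther, SimpleGraph.dist_eq_one_iff_adj]

theorem IsDistanceRegularWith.isRegularOfDegree (hG : IsDistanceRegularWith G b c)
    [G.LocallyFinite] : G.IsRegularOfDegree (b 0) := fun x ↦ by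
  rw [← ncard_neighborSet hG x, Set.ncard_eq_toFinset_card', Set.toFinset_card,
    SimpleGraph.card_neighborSet_eq_degree]

theorem c_one (hG : IsDistanceRegularWith G b c) (hxy : G.Adj x y) : c 1 = 1 := by
  have hdist := SimpleGraph.dist_eq_one_iff_adj.2 hxy
  have hcard := hG.ncard_nearer x y
  rw [hdist] at hcard
  rw [← hcard, Set.ncard_eq_one]
  refine ⟨x, Set.ext fun z ↦ ⟨fun hz ↦ ?_, ?_⟩⟩
  · have := hz.2
    exact (hG.1.dist_eq_zero_iff.1 (by omega)).symm
  · rintro rfl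
    exact ⟨hxy.symm, by rw [hdist, SimpleGraph.dist_self]⟩

theorem nearer_subset_of_between (hc : G.Connected)
    (h : G.dist x y = G.dist x x' + G.dist x' y) : nearer G x' y ⊆ nearer G x y := by
  rintro z ⟨hz, hd⟩
  have := hc.dist_triangle (u := x) (v := x') (w := z)
  exact ⟨hz, by grind [hz.diff_dist_adj (u := x)]⟩

theorem farther_subset_of_between (hc : G.Connected)
    (h : G.dist x y = G.dist x x' + G.dist x' y) : farther G x y ⊆ farther G x' y := by
  rintro z ⟨hz, hd⟩
  have := hc.dist_triangle (u := x) (v := x') (w := z)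
  exact ⟨hz, by grind [hz.diff_dist_adj (u := x')]⟩

theorem exists_mem_nearer (hc : G.Connected) (h : 0 < G.dist x y) : ∃ z, z ∈ nearer G x y := by
  obtain ⟨p, hp⟩ := hc.exists_walk_length_eq_dist y x
  cases p with
  | nil => simp at h
  | @cons _ z _ hz q =>
    have hq := SimpleGraph.dist_le q
    rw [SimpleGraph.Walk.length_cons] at hp
    exact ⟨z, hz, by grind [G.dist_comm, hz.diff_dist_adj (u := x)]⟩

theorem exists_between (hc : G.Connected) {n : ℕ} (h : n ≤ G.dist x y) :
    ∃ z, G.dist x z = n ∧ n + G.dist z y = G.dist x y := by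
  obtain ⟨m, hm⟩ := Nat.exists_eq_add_of_le h
  induction m generalizing y with
  | zero => exact ⟨y, by simpa using hm, by simp; omega⟩
  | succ m ih =>
    obtain ⟨y', hy', hd⟩ := exists_mem_nearer hc (x := x) (y := y) (by omega)
    obtain ⟨z, hz, hz'⟩ := ih (y := y') (by omega) (by omega)
    have := hc.dist_triangle (u := x) (v := z) (w := y)
    exact ⟨z, hz, by grind [hy'.diff_dist_adj (u := z)]⟩

theorem exists_dist_eq_of_le (hc : G.Connected) {N n : ℕ} (hN : ∃ x y, G.dist x y = N)
    (hn : n ≤ N) : ∃ x y, G.dist x y = n := by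
  obtain ⟨x, y, rfl⟩ := hN
  obtain ⟨z, hz, -⟩ := exists_between hc hn
  exact ⟨x, z, hz⟩

variable [Finite V]

theorem nearer_eq_of_between (hG : IsDistanceRegularWith G b c)
    (h : G.dist x y = G.dist x x' + G.dist x' y) (he : c (G.dist x' y) = c (G.dist x y)) :
    nearer G x' y = nearer G x y :=
  Set.eq_of_subset_of_ncard_le (nearer_subset_of_between hG.1 h)
    (by rw [hG.ncard_nearer, hG.ncard_nearer, he])

theorem farther_eq_of_between (hG : IsDistanceRegularWith G b c)
    (h : G.dist x y = G.dist x x' + G.dist x' y) (he : b (G.dist x' y) = b (G.dist x y)) :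
    farther G x y = farther G x' y :=
  Set.eq_of_subset_of_ncard_le (farther_subset_of_between hG.1 h)
    (by rw [hG.ncard_farther, hG.ncard_farther, he])

section Monotone

variable {N i j : ℕ}

theorem IsDistanceRegularWith.c_mono (hG : IsDistanceRegularWith G b c)
    (hN : ∃ x y, G.dist x y = N) (hij : i ≤ j) (hj : j ≤ N) : c i ≤ c j := by
  obtain ⟨x, y, hxy⟩ := exists_dist_eq_of_le hG.1 hN hj
  obtain ⟨z, hz, hz'⟩ := exists_between hG.1 (x := x) (y := y) (n := j - i) (by omega)
  have hsub := nearer_subset_of_between hG.1 (x := x) (x' := z) (y := y) (by omega)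
  have hle := Set.ncard_le_ncard hsub
  rwa [hG.ncard_nearer, hG.ncard_nearer, hxy, show G.dist z y = i by omega] at hle

theorem IsDistanceRegularWith.b_anti (hG : IsDistanceRegularWith G b c)
    (hN : ∃ x y, G.dist x y = N) (hij : i ≤ j) (hj : j ≤ N) : b j ≤ b i := by
  obtain ⟨x, y, hxy⟩ := exists_dist_eq_of_le hG.1 hN hj
  obtain ⟨z, hz, hz'⟩ := exists_between hG.1 (x := x) (y := y) (n := j - i) (by omega)
  have hsub := farther_subset_of_between hG.1 (x := x) (x' := z) (y := y) (by omega)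
  have hle := Set.ncard_le_ncard hsub
  rwa [hG.ncard_farther, hG.ncard_farther, hxy, show G.dist z y = i by omega] at hle

theorem IsDistanceRegularWith.exists_mem_farther (hG : IsDistanceRegularWith G b c)
    (hN : ∃ x y, G.dist x y = N) (h : G.dist x y < N) : ∃ z, z ∈ farther G x y := by
  obtain ⟨u, v, huv⟩ := exists_dist_eq_of_le hG.1 hN h
  obtain ⟨w, hw, hwv⟩ := exists_mem_nearer hG.1 (x := u) (y := v) (by omega)
  have hpos : 0 < (farther G u w).ncard := (Set.ncard_pos).2 ⟨v, hw.symm, hwv.symm⟩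
  rw [hG.ncard_farther, show G.dist u w = G.dist x y by omega, ← hG.ncard_farther] at hpos
  exact (Set.ncard_pos).1 hpos

theorem IsDistanceRegularWith.exists_extend (hG : IsDistanceRegularWith G b c)
    (hN : ∃ x y, G.dist x y = N) {m : ℕ} (hm : G.dist x y + m ≤ N) :
    ∃ z, G.dist x z = G.dist x y + m ∧ G.dist y z = m := by
  induction m with
  | zero => exact ⟨y, by simp⟩
  | succ m ih =>
    obtain ⟨z, hz, hz'⟩ := ih (by omega)
    obtain ⟨w, hw, hd⟩ := hG.exists_mem_farther hN (x := x) (y := z) (by omega)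
    have := hG.1.dist_triangle (u := x) (v := y) (w := w)
    exact ⟨w, by omega, by grind [hw.diff_dist_adj (u := y)]⟩

end Monotone

section EvenCircuit

variable {i : ℕ} {u v w t : V}

theorem nearer_eq_of_dist_eq (hG : IsDistanceRegularWith G b c)
    (hcc : ∀ j, i ≤ j → j ≤ 2 * i - 1 → c j = c i) (hxt : G.dist x t = 2 * i - 1)
    (hxv : G.dist x v = i) (hvt : G.dist v t + 1 = i) : nearer G v x = nearer G t x := by
  apply nearer_eq_of_between hG
  · grind [G.dist_comm]
  · rw [G.dist_comm, hxv, G.dist_comm, hxt, hcc (2 * i - 1) (by omega) le_rfl]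

theorem dist_of_mem_nearer (hG : IsDistanceRegularWith G b c)
    (hcc : ∀ j, i ≤ j → j ≤ 2 * i - 1 → c j = c i) (hxt : G.dist x t = 2 * i - 1)
    (hw : w ∈ nearer G t x) (hxu : G.dist x u + 1 = i) (hut : G.dist u t = i)
    (hz : z ∈ nearer G t u) : G.dist w z + 1 = i ∧ G.dist z t + 1 = i := by
  obtain ⟨huz, hd⟩ := hz
  have hzt : G.dist z t + 1 = i := by grind [G.dist_comm]
  have hxz : G.dist x z = i := by
    have := hG.1.dist_triangle (u := x) (v := z) (w := t)
    grind [huz.diff_dist_adj (u := x)]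
  rw [← nearer_eq_of_dist_eq hG hcc hxt hxz hzt] at hw
  exact ⟨by have := hw.2; grind [G.dist_comm], hzt⟩

theorem exists_mem_nearer_of_crossing (hG : IsDistanceRegularWith G b c)
    (hN : ∃ x y, G.dist x y = 2 * i - 1) (hcc : ∀ j, i ≤ j → j ≤ 2 * i - 1 → c j = c i)
    (hxw : G.Adj x w) (huv : G.Adj u v) (hxv : G.dist x v = i) (hwv : G.dist w v + 1 = i)
    (hxu : G.dist x u + 1 = i) :
    ∃ t, G.dist x t = 2 * i - 1 ∧ G.dist u t = i ∧ w ∈ nearer G t x := by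
  obtain ⟨t, hxt, hvt⟩ := hG.exists_extend hN (x := x) (y := v) (m := i - 1) (by omega)
  have := hG.1.dist_triangle (u := x) (v := u) (w := t)
  refine ⟨t, by omega, by grind [G.dist_comm, huv.diff_dist_adj (u := t)], ?_⟩
  rw [← nearer_eq_of_dist_eq hG hcc (by omega) hxv (by omega)]
  exact ⟨hxw, by grind [G.dist_comm]⟩

theorem dist_ne_of_even_circuit (hG : IsDistanceRegularWith G b c)
    (hN : ∃ x y, G.dist x y = 2 * i - 1) (hcc : ∀ j, i ≤ j → j ≤ 2 * i - 1 → c j = c i)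
    (hxw : G.Adj x w) (huv : G.Adj u v) (hxv : G.dist x v = i) (hwv : G.dist w v + 1 = i)
    (hxu : G.dist x u + 1 = i) (hi : 2 ≤ i) : G.dist w u ≠ i := by
  intro hwu
  have hc := hG.1
  obtain ⟨t, hxt, hut, hwt⟩ := exists_mem_nearer_of_crossing hG hN hcc hxw huv hxv hwv hxu
  obtain ⟨u', hu', hd⟩ := exists_mem_nearer hc (x := x) (y := u) (by omega)
  have hwu' : u' ∈ nearer G w u := by
    have := hc.dist_triangle (u := w) (v := x) (w := u')
    rw [SimpleGraph.dist_eq_one_iff_adj.2 hxw.symm] at this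
    exact ⟨hu', by grind [hu'.diff_dist_adj (u := w)]⟩
  have htu' : u' ∉ nearer G t u := by
    have := hc.dist_triangle (u := x) (v := u') (w := t)
    intro h
    have := h.2
    grind [G.dist_comm]
  obtain ⟨z, hz, hzw⟩ := exists_mem_notMem_of_ncard_le
    (by rw [hG.ncard_nearer, hG.ncard_nearer, hwu, G.dist_comm, hut]) hwu' htu'
  exact hzw ⟨hz.1, by
    rw [hwu]; exact (dist_of_mem_nearer hG hcc (by omega) hwt hxu hut hz).1⟩

end EvenCircuit

section ConstantRange

variable {i R : ℕ} {v v' : V}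

theorem farther_subset_of_adj (hG : IsDistanceRegularWith G b c)
    (hcc : ∀ j, i ≤ j → j ≤ R + 1 → c j = c i) (hadj : G.Adj v v') (h1 : i ≤ G.dist y v)
    (h2 : G.dist y v ≤ R) (heq : G.dist y v = G.dist y v') : farther G v y ⊆ farther G v' y := by
  rintro z ⟨hz, hd⟩
  have hzv : G.dist z v = G.dist y v + 1 := by grind [G.dist_comm]
  have hnear : nearer G y v = nearer G z v := by
    apply nearer_eq_of_between hG
    · rw [SimpleGraph.dist_eq_one_iff_adj.2 hz.symm, hzv, add_comm]
    · rw [hzv, hcc _ h1 (by omega), hcc (G.dist y v + 1) (by omega) (by omega)]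
  have hv' : v' ∉ nearer G z v := fun h ↦ by rw [← hnear] at h; exact absurd h.2 (by omega)
  have hzv' : G.dist z v' + 1 ≠ G.dist z v := fun h ↦ hv' ⟨hadj, h⟩
  exact ⟨hz, by grind [G.dist_comm, hadj.diff_dist_adj (u := z), hz.diff_dist_adj (u := v')]⟩

theorem farther_eq_of_adj_of_dist_succ (hG : IsDistanceRegularWith G b c)
    (hbb : ∀ j, i ≤ j → j ≤ R → b j = b i) (hadj : G.Adj v v') (h1 : i ≤ G.dist y v)
    (h2 : G.dist y v' ≤ R) (heq : G.dist y v' = G.dist y v + 1) :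
    farther G v' y = farther G v y := by
  apply farther_eq_of_between hG
  · rw [SimpleGraph.dist_eq_one_iff_adj.2 hadj.symm]
    grind [G.dist_comm]
  · rw [G.dist_comm, G.dist_comm (u := v'), hbb _ h1 (by omega), hbb _ (by omega) h2]

theorem farther_eq_of_adj (hG : IsDistanceRegularWith G b c)
    (hcc : ∀ j, i ≤ j → j ≤ R + 1 → c j = c i) (hbb : ∀ j, i ≤ j → j ≤ R → b j = b i)
    (hadj : G.Adj v v') (h1 : i ≤ G.dist y v) (h2 : G.dist y v ≤ R)
    (h1' : i ≤ G.dist y v') (h2' : G.dist y v' ≤ R) : farther G v y = farther G v' y := by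
  rcases hadj.diff_dist_adj (u := y) with h | h | h
  · exact (farther_subset_of_adj hG hcc hadj h1 h2 h.symm).antisymm
      (farther_subset_of_adj hG hcc hadj.symm h1' h2' h)
  · exact (farther_eq_of_adj_of_dist_succ hG hbb hadj h1 h2' h).symm
  · rcases (G.dist y v).eq_zero_or_pos with h0 | h0
    · exact (farther_subset_of_adj hG hcc hadj h1 h2 (by omega)).antisymm
        (farther_subset_of_adj hG hcc hadj.symm h1' h2' (by omega))
    · exact farther_eq_of_adj_of_dist_succ hG hbb hadj.symm h1' h2 (by omega)

theorem exists_between_of_farther_ne (hG : IsDistanceRegularWith G b c)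
    (hcc : ∀ j, i ≤ j → j ≤ R + 1 → c j = c i) (hbb : ∀ j, i ≤ j → j ≤ R → b j = b i)
    (h1 : i ≤ G.dist y v) (h2 : G.dist y v + G.dist v v' ≤ R)
    (hne : farther G v y ≠ farther G v' y) :
    ∃ g, G.dist y g < i ∧ G.dist v g + G.dist g v' = G.dist v v' := by
  have hc := hG.1
  obtain ⟨n, hn⟩ : ∃ n, G.dist v v' = n := ⟨_, rfl⟩
  induction n generalizing v with
  | zero => exact absurd (by rw [hc.dist_eq_zero_iff.1 hn]) hne
  | succ n ih =>
    obtain ⟨p, hp, hd⟩ := exists_mem_nearer hc (x := v') (y := v) (by rw [G.dist_comm]; omega)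
    have hvp := SimpleGraph.dist_eq_one_iff_adj.2 hp
    rw [G.dist_comm, G.dist_comm (u := v')] at hd
    by_cases hpi : i ≤ G.dist y p
    · have hyp : G.dist y p ≤ G.dist y v + 1 := by grind [hp.diff_dist_adj (u := y)]
      rw [farther_eq_of_adj hG hcc hbb hp h1 (by omega) hpi (by omega)] at hne
      obtain ⟨g, hg, hg'⟩ := ih hpi (by omega) hne (by omega)
      have := hc.dist_triangle (u := v) (v := p) (w := g)
      have := hc.dist_triangle (u := v) (v := g) (w := v')
      exact ⟨g, hg, by omega⟩
    · exact ⟨p, by omega, by omega⟩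

theorem dist_add_dist_le_of_farther_ne (hG : IsDistanceRegularWith G b c)
    (hcc : ∀ j, i ≤ j → j ≤ R + 1 → c j = c i) (hbb : ∀ j, i ≤ j → j ≤ R → b j = b i)
    (h1 : i ≤ G.dist y v) (h1' : i ≤ G.dist y v')
    (h2 : min (G.dist y v) (G.dist y v') + G.dist v v' ≤ R)
    (hne : farther G v y ≠ farther G v' y) :
    G.dist y v + G.dist y v' ≤ G.dist v v' + 2 * (i - 1) := by
  wlog hle : G.dist y v ≤ G.dist y v' generalizing v v'
  · rw [add_comm, G.dist_comm (u := v)]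
    exact this h1' h1 (by rwa [min_comm, G.dist_comm (u := v')]) hne.symm (by omega)
  obtain ⟨g, hg, hg'⟩ := exists_between_of_farther_ne hG hcc hbb h1 (by omega) hne
  have := hG.1.dist_triangle (u := y) (v := g) (w := v)
  have := hG.1.dist_triangle (u := y) (v := g) (w := v')
  grind [G.dist_comm]

theorem nearer_eq_of_farther_ne (hG : IsDistanceRegularWith G b c)
    (hcc : ∀ j, i ≤ j → j ≤ R + 1 → c j = c i) (hbb : ∀ j, i ≤ j → j ≤ R → b j = b i)
    (h1 : i ≤ G.dist y v) (h1R : G.dist y v < R) (h1' : i ≤ G.dist y v')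
    (h2 : min (G.dist y v) (G.dist y v') + G.dist v v' ≤ R) (h3 : i ≤ G.dist v v')
    (htight : G.dist y v + G.dist y v' = G.dist v v' + 2 * (i - 1))
    (hne : farther G v y ≠ farther G v' y) : nearer G v' v = nearer G y v := by
  refine Set.eq_of_subset_of_ncard_le ?_ ?_
  · rintro f ⟨hf, hfd⟩
    by_contra hcon
    have hyf : G.dist y v ≤ G.dist y f ∧ G.dist y f ≤ G.dist y v + 1 := by
      have : G.dist y f + 1 ≠ G.dist y v := fun h ↦ hcon ⟨hf, h⟩
      grind [hf.diff_dist_adj (u := y)]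
    rw [farther_eq_of_adj hG hcc hbb hf h1 h1R.le (by omega) (by omega)] at hne
    rw [G.dist_comm, G.dist_comm (v := v)] at hfd
    have := dist_add_dist_le_of_farther_ne hG hcc hbb (by omega) h1' (by omega) hne
    omega
  · rw [hG.ncard_nearer, hG.ncard_nearer, G.dist_comm (u := v'), hcc _ h3 (by omega),
      hcc _ h1 (by omega)]

end ConstantRange

section Descent

variable {i : ℕ} {h u u' : V}

theorem exists_dist_eq_of_farther_ne (hG : IsDistanceRegularWith G b c) (hi : 2 ≤ i)
    (hN : ∃ x y, G.dist x y = 2 * i - 1)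
    (hcc : ∀ j, i ≤ j → j ≤ 2 * i + 1 → c j = c i) (hbb : ∀ j, i ≤ j → j ≤ 2 * i → b j = b i)
    (hyh : G.dist y h + 1 = i) (hu : u ∈ farther G y h) (hu' : u' ∈ farther G y h)
    (hne : farther G u y ≠ farther G u' y) :
    ∃ e, G.dist y e = 2 * i - 2 ∧ G.dist h e + 1 = i ∧ G.dist u' e = i ∧
      farther G u' y ≠ farther G e y := by
  have hyu := hu.2
  have hyu' := hu'.2
  have hhu := SimpleGraph.dist_eq_one_iff_adj.2 hu.1
  have hhu' := SimpleGraph.dist_eq_one_iff_adj.2 hu'.1.symm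
  obtain ⟨e, hye, hue⟩ := hG.exists_extend hN (x := y) (y := u) (m := i - 2) (by omega)
  have hfar : farther G e y = farther G u y := by
    apply farther_eq_of_between hG
    · grind [G.dist_comm]
    · rw [G.dist_comm, G.dist_comm (u := e), hbb _ (by omega) (by omega),
        hbb (G.dist y e) (by omega) (by omega)]
  rw [← hfar] at hne
  have hhe := hG.1.dist_triangle (u := h) (v := u) (w := e)
  have hu'e := hG.1.dist_triangle (u := u') (v := h) (w := e)
  have hsep := dist_add_dist_le_of_farther_ne hG hcc hbb (by omega) (by omega) (by omega) hne.symm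
  exact ⟨e, by omega, by omega, by omega, hne.symm⟩

theorem exists_adj_dist_eq_of_b_lt (hG : IsDistanceRegularWith G b c)
    (hN : ∃ x y, G.dist x y = 2 * i - 1) (hcc : ∀ j, i ≤ j → j ≤ 2 * i - 1 → c j = c i)
    (hlt : b i < b (i - 1)) {e : V} (hhu : G.Adj h u) (hhe : G.dist h e + 1 = i)
    (hue : G.dist u e = i) (hi : 2 ≤ i) :
    ∃ e', G.Adj e e' ∧ G.dist h e' = i ∧ G.dist u e' = i := by
  obtain ⟨e', ⟨hee', hhe'⟩, hnot⟩ : ∃ e' ∈ farther G h e, e' ∉ farther G u e := by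
    refine Set.exists_mem_notMem_of_ncard_lt_ncard ?_
    rwa [hG.ncard_farther, hG.ncard_farther, hue, show G.dist h e = i - 1 by omega]
  have hup : G.dist u e' ≠ G.dist u e + 1 := fun h ↦ hnot ⟨hee', h⟩
  have hdown : G.dist u e' + 1 ≠ i := fun h ↦
    dist_ne_of_even_circuit hG hN hcc hhu.symm hee'.symm hue hhe h hi (by omega)
  exact ⟨e', hee', by omega, by grind [hee'.diff_dist_adj (u := u)]⟩

theorem farther_eq_of_mem_farther (hG : IsDistanceRegularWith G b c) (hi : 2 ≤ i)
    (hN : ∃ x y, G.dist x y = 2 * i - 1)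
    (hcc : ∀ j, i ≤ j → j ≤ 2 * i + 1 → c j = c i) (hbb : ∀ j, i ≤ j → j ≤ 2 * i → b j = b i)
    (hlt : b i < b (i - 1)) (hyh : G.dist y h + 1 = i) (hu : u ∈ farther G y h)
    (hu' : u' ∈ farther G y h) : farther G u y = farther G u' y := by
  by_contra hne
  obtain ⟨e, hye, hhe, hu'e, hne'⟩ := exists_dist_eq_of_farther_ne hG hi hN hcc hbb hyh hu hu' hne
  obtain ⟨hhu', hyu'⟩ := hu'
  have hnear_u' : nearer G e u' = nearer G y u' := nearer_eq_of_farther_ne hG hcc hbb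
    (by omega) (by omega) (by omega) (by omega) (by omega) (by omega) hne'
  have hnear_e : nearer G u' e = nearer G y e := nearer_eq_of_farther_ne hG hcc hbb
    (by omega) (by omega) (by omega) (by grind [G.dist_comm]) (by grind [G.dist_comm])
    (by grind [G.dist_comm]) hne'.symm
  obtain ⟨e', hee', hhe', hu'e'⟩ := exists_adj_dist_eq_of_b_lt hG hN
    (fun j h1 h2 ↦ hcc j h1 (by omega)) hlt hhu' hhe hu'e hi
  obtain ⟨f, ⟨hf, hfd⟩, hfn⟩ : ∃ f ∈ nearer G e' u', f ∉ nearer G e u' :=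
    exists_mem_notMem_of_ncard_le (a := h)
      (by rw [hG.ncard_nearer, hG.ncard_nearer, G.dist_comm, hu'e, G.dist_comm, hu'e'])
      ⟨hhu'.symm, by grind [G.dist_comm]⟩ fun hh ↦ by have := hh.2; grind [G.dist_comm]
  have hyf : i ≤ G.dist y f ∧ G.dist y f ≤ i + 1 := by
    have : G.dist y f + 1 ≠ G.dist y u' := fun h ↦ hfn (hnear_u' ▸ ⟨hf, h⟩)
    grind [hf.diff_dist_adj (u := y)]
  have hye' : 2 * i - 2 ≤ G.dist y e' ∧ G.dist y e' ≤ 2 * i - 1 := by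
    have : e' ∉ nearer G y e := fun h ↦ by
      rw [← hnear_e] at h; exact absurd h.2 (by omega)
    have : G.dist y e' + 1 ≠ G.dist y e := fun h ↦ this ⟨hee', h⟩
    grind [hee'.diff_dist_adj (u := y)]
  rw [farther_eq_of_adj hG hcc hbb hf (by omega) (by omega) hyf.1 (by omega),
    farther_eq_of_adj hG hcc hbb hee' (by omega) (by omega) (by omega) (by omega)] at hne'
  rw [G.dist_comm, G.dist_comm (u := e')] at hfd
  have := dist_add_dist_le_of_farther_ne hG hcc hbb (by omega) (by omega) (by omega) hne'
  omega

theorem b_pred_eq_of_constant (hG : IsDistanceRegularWith G b c) (hi : 2 ≤ i)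
    (hN : ∃ x y, G.dist x y = 2 * i - 1)
    (hcc : ∀ j, i ≤ j → j ≤ 2 * i + 1 → c j = c i)
    (hbb : ∀ j, i ≤ j → j ≤ 2 * i → b j = b i) : b (i - 1) = b i := by
  refine le_antisymm ?_ (hG.b_anti hN (by omega) (by omega))
  by_contra! hlt
  obtain ⟨y, h, hyh⟩ := exists_dist_eq_of_le hG.1 hN (n := i - 1) (by omega)
  obtain ⟨u, hu⟩ := hG.exists_mem_farther hN (x := y) (y := h) (by omega)
  have hyu := hu.2
  obtain ⟨y', hyy', hy'⟩ := hG.exists_mem_farther hN (x := u) (y := y) (by grind [G.dist_comm])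
  have hy'h : G.dist y' h = i := by
    grind [G.dist_comm, hyy'.diff_dist_adj (u := h), hu.1.diff_dist_adj (u := y')]
  have hsub : farther G y h ⊆ farther G y' h := by
    intro u' hu'
    have hmem : y' ∈ farther G u' y := by
      rw [← farther_eq_of_mem_farther hG hi hN hcc hbb hlt (by omega) hu hu']
      exact ⟨hyy', hy'⟩
    exact ⟨hu'.1, by have := hmem.2; have := hu'.2; grind [G.dist_comm]⟩
  have hle := Set.ncard_le_ncard hsub
  rw [hG.ncard_farther, hG.ncard_farther, hy'h, hyh] at hle
  omega

theorem exists_crossing_of_c_pred_lt (hG : IsDistanceRegularWith G b c) (hi : 2 ≤ i)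
    (hN : ∃ x y, G.dist x y = 2 * i - 1) (hcc : ∀ j, i ≤ j → j ≤ 2 * i - 1 → c j = c i)
    (hlt : c (i - 1) < c i) :
    ∃ x w u v : V, G.Adj x w ∧ G.Adj u v ∧ G.dist x v = i ∧ G.dist w v + 1 = i ∧
      G.dist x u + 1 = i ∧ G.dist w u + 1 = i := by
  obtain ⟨x, v, hxv⟩ := exists_dist_eq_of_le hG.1 hN (n := i) (by omega)
  obtain ⟨u, hvu, hxu⟩ := exists_mem_nearer hG.1 (x := x) (y := v) (by omega)
  obtain ⟨w, ⟨hxw, hvw⟩, hwn⟩ : ∃ w ∈ nearer G v x, w ∉ nearer G u x := by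
    refine Set.exists_mem_notMem_of_ncard_lt_ncard ?_
    rwa [hG.ncard_nearer, hG.ncard_nearer, G.dist_comm, G.dist_comm (u := v), hxv,
      show G.dist x u = i - 1 by omega]
  have hwv : G.dist w v + 1 = i := by grind [G.dist_comm]
  have hwu : G.dist w u ≠ i :=
    dist_ne_of_even_circuit hG hN hcc hxw hvu.symm hxv hwv (by omega) hi
  have hwu' : G.dist u w + 1 ≠ G.dist u x := fun h ↦ hwn ⟨hxw, h⟩
  refine ⟨x, w, u, v, hxw, hvu.symm, hxv, hwv, by omega, ?_⟩
  grind [G.dist_comm, hxw.diff_dist_adj (u := u), hvu.diff_dist_adj (u := w)]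

theorem exists_mem_nearer_notMem_nearer (hG : IsDistanceRegularWith G b c) {w w' t : V}
    (hww' : G.Adj w w') (hwu : G.dist w u + 1 = i) (huw' : G.dist u w' = i)
    (hut : G.dist u t = i) (htw : G.dist t w + 2 = 2 * i) (hi : 2 ≤ i) :
    ∃ z ∈ nearer G t u, z ∉ nearer G w' u := by
  obtain ⟨g, hg, hwg⟩ := exists_mem_nearer hG.1 (x := w) (y := u) (by omega)
  refine exists_mem_notMem_of_ncard_le (a := g) ?_ ⟨hg, ?_⟩ fun htg ↦ ?_
  · rw [hG.ncard_nearer, hG.ncard_nearer, G.dist_comm, huw', G.dist_comm (u := t), hut]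
  · grind [G.dist_comm, hww'.diff_dist_adj (u := g), hg.diff_dist_adj (u := w')]
  · have := htg.2
    have := hG.1.dist_triangle (u := t) (v := g) (w := w)
    grind [G.dist_comm]

theorem c_pred_eq_of_constant (hG : IsDistanceRegularWith G b c) (hi : 2 ≤ i)
    (hN : ∃ x y, G.dist x y = 2 * i - 1) (hcc : ∀ j, i ≤ j → j ≤ 2 * i - 1 → c j = c i)
    (hbb : b (2 * i - 2) = b (i - 1)) : c (i - 1) = c i := by
  refine le_antisymm (hG.c_mono hN (by omega) (by omega)) ?_
  by_contra! hlt
  obtain ⟨x, w, u, v, hxw, huv, hxv, hwv, hxu, hwu⟩ :=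
    exists_crossing_of_c_pred_lt hG hi hN hcc hlt
  obtain ⟨t, hxt, hut, hwt⟩ := exists_mem_nearer_of_crossing hG hN hcc hxw huv hxv hwv hxu
  have htw : G.dist t w = 2 * i - 2 := by have := hwt.2; grind [G.dist_comm]
  obtain ⟨w', ⟨hww', huw'⟩, hw'n⟩ : ∃ w' ∈ farther G u w, w' ∉ farther G t w := by
    refine exists_mem_notMem_of_ncard_le (a := x) ?_ ⟨hxw.symm, by grind [G.dist_comm]⟩
      fun hx ↦ by have := hx.2; grind [G.dist_comm]
    rw [hG.ncard_farther, hG.ncard_farther, htw, show G.dist u w = i - 1 by grind [G.dist_comm],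
      hbb]
  obtain ⟨v', hv', hv'w'⟩ :=
    exists_mem_nearer_notMem_nearer hG hww' hwu (by grind [G.dist_comm]) hut (by omega) hi
  obtain ⟨hwv', hv't⟩ := dist_of_mem_nearer hG hcc (by omega) hwt hxu hut hv'
  have hw'v' : w' ∈ farther G v' w := by
    have : G.dist w' v' + 1 ≠ G.dist w' u := fun h ↦ hv'w' ⟨hv'.1, h⟩
    refine ⟨hww', ?_⟩
    grind [G.dist_comm, hww'.diff_dist_adj (u := v'), hv'.1.diff_dist_adj (u := w')]
  refine hw'n (farther_eq_of_between hG (x := t) (x' := v') ?_ ?_ ▸ hw'v')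
  · grind [G.dist_comm]
  · rw [htw, hbb, G.dist_comm, ← hwv', Nat.add_sub_cancel]

end Descent

theorem c_le_valency (hG : IsDistanceRegularWith G b c) (x y : V) : c (G.dist x y) ≤ b 0 := by
  rw [← hG.ncard_nearer, ← ncard_neighborSet hG y]
  exact Set.ncard_le_ncard fun z hz ↦ hz.1

theorem not_constant_of_two_le_c_two (hG : IsDistanceRegularWith G b c) (h2 : 2 ≤ c 2) {i : ℕ}
    (hi : 1 ≤ i) (hN : ∃ x y, G.dist x y = 3 * i) : ¬ (c i = c (3 * i) ∧ b i = b (3 * i)) := by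
  have hc := hG.1
  induction i, hi using Nat.le_induction with
  | base =>
    rintro ⟨h, -⟩
    obtain ⟨x, y, hxy⟩ := exists_dist_eq_of_le hc hN (n := 1) (by omega)
    have h1 := c_one hG (SimpleGraph.dist_eq_one_iff_adj.1 hxy)
    have h3 : c 2 ≤ c (3 * 1) := hG.c_mono hN (by omega) le_rfl
    omega
  | succ i hi ih =>
    rintro ⟨h, h'⟩
    have hcc : ∀ j, i + 1 ≤ j → j ≤ 3 * (i + 1) → c j = c (i + 1) := fun j h1 h2 ↦
      le_antisymm (h ▸ hG.c_mono hN h2 le_rfl) (hG.c_mono hN h1 h2)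
    have hbb : ∀ j, i + 1 ≤ j → j ≤ 3 * (i + 1) → b j = b (i + 1) := fun j h1 h2 ↦
      le_antisymm (hG.b_anti hN h1 h2) (h' ▸ hG.b_anti hN h2 le_rfl)
    have hN' : ∃ x y, G.dist x y = 2 * (i + 1) - 1 := exists_dist_eq_of_le hc hN (by omega)
    have hb : b i = b (i + 1) := b_pred_eq_of_constant hG (by omega) hN'
      (fun j h1 h2 ↦ hcc j h1 (by omega)) (fun j h1 h2 ↦ hbb j h1 (by omega))
    have hc' : c i = c (i + 1) := c_pred_eq_of_constant hG (by omega) hN'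
      (fun j h1 h2 ↦ hcc j h1 (by omega)) ((hbb _ (by omega) (by omega)).trans hb.symm)
    refine ih (exists_dist_eq_of_le hc hN (by omega)) ⟨?_, ?_⟩
    · rw [hc', hcc (3 * i) (by omega) (by omega)]
    · rw [hb, hbb (3 * i) (by omega) (by omega)]

theorem add_b_le_c_add_valency (hG : IsDistanceRegularWith G b c) (h2 : 2 ≤ c 2) {n : ℕ}
    (hN : ∃ x y, G.dist x y = 3 ^ n) : n + b (3 ^ n) ≤ c (3 ^ n) + b 0 := by
  induction n with
  | zero => have := hG.b_anti hN (zero_le (a := 3 ^ 0)) le_rfl; omega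
  | succ n ih =>
    have hle : 3 ^ n ≤ 3 ^ (n + 1) := Nat.pow_le_pow_right (by omega) (by omega)
    have hc := hG.c_mono hN hle le_rfl
    have hb := hG.b_anti hN hle le_rfl
    have hih := ih (exists_dist_eq_of_le hG.1 hN hle)
    rw [pow_succ'] at hN hc hb ⊢
    have := not_constant_of_two_le_c_two hG h2 (Nat.one_le_pow _ _ (by omega)) hN
    omega

theorem dist_lt_of_two_le_c_two (hG : IsDistanceRegularWith G b c) (h2 : 2 ≤ c 2) (x y : V) :
    G.dist x y < 3 ^ (2 * b 0 + 1) := by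
  by_contra! hle
  obtain ⟨u, v, huv⟩ := exists_dist_eq_of_le hG.1 ⟨x, y, rfl⟩ hle
  have hgrow := add_b_le_c_add_valency hG h2 ⟨u, v, huv⟩
  have hbound := huv ▸ c_le_valency hG u v
  omega

end DiameterBound

theorem card_le_of_dist_le {V : Type*} [Fintype V] {G : SimpleGraph V} [DecidableRel G.Adj]
    (hc : G.Connected) {k r : ℕ} (hk : ∀ y, G.degree y ≤ k) {x : V}
    (hr : ∀ y, G.dist x y ≤ r) : Fintype.card V ≤ (k + 1) ^ r := by
  classical
  have hball (n : ℕ) : #{y | G.dist x y ≤ n} ≤ (k + 1) ^ n := by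
    induction n with
    | zero =>
      refine card_le_one.2 fun p hp q hq ↦ ?_
      simp only [mem_filter_univ, Nat.le_zero, hc.dist_eq_zero_iff] at hp hq
      exact hp.symm.trans hq
    | succ n ih =>
      have hcover : ({y | G.dist x y ≤ n + 1} : Finset V) ⊆
          ({y | G.dist x y ≤ n} : Finset V).biUnion fun y ↦ insert y (G.neighborFinset y) := by
        intro y hy
        obtain rfl | hne := eq_or_ne x y
        · exact mem_biUnion.2 ⟨x, by simp, mem_insert_self _ _⟩
        obtain ⟨z, hz, hd⟩ := exists_mem_nearer hc (hc.pos_dist_of_ne hne)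
        rw [mem_filter_univ] at hy
        exact mem_biUnion.2 ⟨z, by simp; omega, by simp [hz.symm]⟩
      calc #{y | G.dist x y ≤ n + 1}
          ≤ #{y | G.dist x y ≤ n} * (k + 1) := (card_le_card hcover).trans <|
            card_biUnion_le_card_mul _ _ _ fun y _ ↦
              (card_insert_le _ _).trans (Nat.succ_le_succ (hk y))
        _ ≤ (k + 1) ^ (n + 1) := by rw [pow_succ]; gcongr
  rw [← card_univ, ← filter_true_of_mem (s := univ) fun y _ ↦ hr y]
  exact hball r

theorem exists_card_le_card_mul_card_filter {α β : Type*} {s : Finset α} {t : Finset β}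
    {r : α → β → Prop} [∀ a b, Decidable (r a b)] (hs : s.Nonempty) (h : ∀ a ∈ s, ∃ b ∈ t, r a b) :
    ∃ b ∈ t, #s ≤ #t * #{a ∈ s | r a b} := by
  classical
  obtain ⟨a, ha⟩ := hs
  obtain ⟨b₀, hb₀, -⟩ := h a ha
  have hcover : s ⊆ t.biUnion fun b ↦ {a ∈ s | r a b} := fun a ha ↦ by
    simpa [ha] using h a ha
  obtain ⟨b, hb, hmax⟩ := exists_max_image t (fun b ↦ #{a ∈ s | r a b}) ⟨b₀, hb₀⟩
  exact ⟨b, hb, (card_le_card hcover).trans (card_biUnion_le_card_mul _ _ _ hmax)⟩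

section CliqueCommonNeighbors

variable {W : Type*} {Δ : SimpleGraph W} {μ n : ℕ}

/-- Any two distinct nonadjacent vertices have exactly `μ` common neighbours, and these form a
clique: the property that local graphs inherit from a Terwilliger graph. -/
structure HasCliqueCommonNeighbors (Δ : SimpleGraph W) (μ : ℕ) : Prop where
  isClique : ∀ ⦃y z⦄, y ≠ z → ¬Δ.Adj y z → Δ.IsClique (Δ.commonNeighbors y z)
  ncard_eq : ∀ ⦃y z⦄, y ≠ z → ¬Δ.Adj y z → (Δ.commonNeighbors y z).ncard = μ

/-- `S` is covered by at most `n` cliques, so that one of them contains at least `#S / n` vertices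
of `S`: the source of large cliques. The cliques need not lie in `S`. -/
def CoveredByCliques (Δ : SimpleGraph W) (S : Finset W) (n : ℕ) : Prop :=
  ∃ 𝒦 : Finset (Finset W), #𝒦 ≤ n ∧ (∀ K ∈ 𝒦, Δ.IsClique K) ∧ ∀ v ∈ S, ∃ K ∈ 𝒦, v ∈ K

theorem CoveredByCliques.mono {S T : Finset W} (hT : CoveredByCliques Δ T n) (hST : S ⊆ T) :
    CoveredByCliques Δ S n :=
  let ⟨𝒦, hcard, hclique, hcover⟩ := hT
  ⟨𝒦, hcard, hclique, fun v hv ↦ hcover v (hST hv)⟩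

theorem CoveredByCliques.exists_isClique_card_le {S : Finset W} (hS : CoveredByCliques Δ S n) :
    ∃ K ⊆ S, Δ.IsClique K ∧ #S ≤ n * #K := by
  classical
  obtain rfl | hne := S.eq_empty_or_nonempty
  · exact ⟨∅, by simp⟩
  obtain ⟨𝒦, hcard, hclique, hcover⟩ := hS
  obtain ⟨K, hK, hle⟩ := exists_card_le_card_mul_card_filter hne hcover
  refine ⟨{v ∈ S | v ∈ K}, filter_subset _ _, (hclique K hK).subset fun v ↦ by simp, ?_⟩
  exact hle.trans (Nat.mul_le_mul_right _ hcard)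

theorem exists_not_adj_of_maximal_isClique {L : Finset W} {w : W}
    (hL : Maximal Δ.IsClique (L : Set W)) (hw : w ∉ L) : ∃ z ∈ L, ¬Δ.Adj w z := by
  by_contra! hadj
  have hinsert : Δ.IsClique (insert w (L : Set W)) := hL.prop.insert fun z hz _ ↦ hadj z hz
  exact hw (hL.le_of_ge hinsert (Set.subset_insert w L) (Set.mem_insert w L))

section Cover

variable {I S : Finset W}

theorem exists_isIndepSet_forall_card_le (Δ : SimpleGraph W) (S : Finset W) :
    ∃ I ⊆ S, Δ.IsIndepSet I ∧ ∀ J ⊆ S, Δ.IsIndepSet J → #J ≤ #I := by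
  classical
  obtain ⟨I, hI, hmax⟩ :=
    exists_max_image (S.powerset.filter fun I : Finset W ↦ Δ.IsIndepSet I) card ⟨∅, by simp⟩
  simp only [mem_filter, mem_powerset] at hI hmax
  exact ⟨I, hI.1, hI.2, fun J hJS hJ ↦ hmax J ⟨hJS, hJ⟩⟩

-- Two nonadjacent such vertices could replace `i` in `I`.
theorem isClique_of_forall_ne_of_forall_card_le (hIS : I ⊆ S) (hI : Δ.IsIndepSet I)
    (hmax : ∀ J ⊆ S, Δ.IsIndepSet J → #J ≤ #I) {i : W} (hi : i ∈ I) :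
    Δ.IsClique {v | v ∈ S ∧ ∀ j ∈ I, j ≠ i → j ≠ v ∧ ¬Δ.Adj j v} := by
  rintro v ⟨hvS, hv⟩ w ⟨hwS, hw⟩ hvw
  classical
  by_contra hadj
  have hcard : #(insert v (insert w (I.erase i))) = #I + 1 := by
    rw [card_insert_of_notMem (by grind), card_insert_of_notMem (by grind),
      card_erase_add_one hi]
  have hindep : Δ.IsIndepSet (insert v (insert w (I.erase i)) : Finset W) := by
    intro x hx y hy hxy
    have := @hI x
    grind [Δ.adj_comm]
  have := hmax _ (by grind) hindep
  omega

theorem exists_mem_eq_or_adj_of_forall_card_le (hIS : I ⊆ S) (hI : Δ.IsIndepSet I)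
    (hmax : ∀ J ⊆ S, Δ.IsIndepSet J → #J ≤ #I) {v : W} (hv : v ∈ S) :
    ∃ i ∈ I, i = v ∨ Δ.Adj i v := by
  classical
  by_contra! hcon
  have hindep : Δ.IsIndepSet (insert v I : Finset W) := by
    intro x hx y hy hxy
    have := @hI x
    grind [Δ.adj_comm]
  have := hmax _ (insert_subset hv hIS) hindep
  rw [card_insert_of_notMem (by grind)] at this
  omega

theorem HasCliqueCommonNeighbors.coveredByCliques (hΔ : HasCliqueCommonNeighbors Δ μ)
    (hS : ∀ I ⊆ S, Δ.IsIndepSet I → #I ≤ n) : CoveredByCliques Δ S (n ^ 2) := by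
  classical
  obtain ⟨I, hIS, hI, hmax⟩ := exists_isIndepSet_forall_card_le Δ S
  let K (ij : W × W) : Finset W :=
    if ij.1 = ij.2 then {v ∈ S | ∀ j ∈ I, j ≠ ij.1 → j ≠ v ∧ ¬Δ.Adj j v}
    else {v ∈ S | v ∈ Δ.commonNeighbors ij.1 ij.2}
  refine ⟨(I ×ˢ I).image K, ?_, ?_, fun v hv ↦ ?_⟩
  · calc #((I ×ˢ I).image K) ≤ #(I ×ˢ I) := card_image_le
      _ = #I ^ 2 := by rw [card_product, sq]
      _ ≤ n ^ 2 := Nat.pow_le_pow_left (hS I hIS hI) 2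
  · simp only [mem_image, mem_product, Prod.exists]
    rintro - ⟨i, j, ⟨hi, hj⟩, rfl⟩
    by_cases hij : i = j
    · simpa [K, hij] using isClique_of_forall_ne_of_forall_card_le hIS hI hmax hj
    · exact (hΔ.isClique hij (hI hi hj hij)).subset fun v ↦ by simp [K, hij]
  · obtain ⟨i, hi, hiv⟩ := exists_mem_eq_or_adj_of_forall_card_le hIS hI hmax hv
    by_cases hprivate : ∀ j ∈ I, j ≠ i → j ≠ v ∧ ¬Δ.Adj j v
    · exact ⟨K (i, i), mem_image_of_mem _ (by simp [hi]), by simpa [K, hv] using hprivate⟩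
    · push Not at hprivate
      obtain ⟨j, hj, hji, hjv⟩ := hprivate
      have hij : ¬Δ.Adj i j := hI hi hj hji.symm
      have hcommon : v ∈ Δ.commonNeighbors i j := by
        rw [mem_commonNeighbors]
        grind [Δ.adj_comm]
      exact ⟨K (i, j), mem_image_of_mem _ (by simp [hi, hj]), by simp [K, hji.symm, hv, hcommon]⟩

end Cover

variable [Fintype W] [DecidableRel Δ.Adj]

theorem eq_top_of_isUniversal {a : ℕ} {v : W} (hreg : Δ.IsRegularOfDegree a)
    (hv : Δ.IsUniversal v) : Δ = ⊤ := by
  refine eq_top_iff_forall_ne_adj.2 fun x y hxy ↦ (Δ.degree_eq_card_sub_one x).1 ?_ hxy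
  rw [hreg.degree_eq, ← hreg.degree_eq v, (Δ.degree_eq_card_sub_one v).2 hv]

section Traces

variable [DecidableEq W] {K L : Finset W} {p q v w y z : W}

theorem HasCliqueCommonNeighbors.isClique_neighborFinset_inter
    (hΔ : HasCliqueCommonNeighbors Δ μ) (hyz : y ≠ z) (hadj : ¬Δ.Adj y z) :
    Δ.IsClique ↑(Δ.neighborFinset y ∩ Δ.neighborFinset z) := by
  simpa [commonNeighbors_eq] using hΔ.isClique hyz hadj

theorem HasCliqueCommonNeighbors.card_neighborFinset_inter (hΔ : HasCliqueCommonNeighbors Δ μ)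
    (hyz : y ≠ z) (hadj : ¬Δ.Adj y z) : #(Δ.neighborFinset y ∩ Δ.neighborFinset z) = μ := by
  rw [← Set.ncard_coe_finset, ← hΔ.ncard_eq hyz hadj]
  simp [commonNeighbors_eq]

theorem HasCliqueCommonNeighbors.inter_subset_or_inter_subset (hΔ : HasCliqueCommonNeighbors Δ μ)
    (hL : Δ.IsClique L) (hpq : Δ.Adj p q) (hp : p ∉ L) (hq : q ∉ L) :
    Δ.neighborFinset p ∩ L ⊆ Δ.neighborFinset q ∩ L ∨
      Δ.neighborFinset q ∩ L ⊆ Δ.neighborFinset p ∩ L := by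
  by_contra! hcon
  simp only [not_subset, mem_inter, mem_neighborFinset] at hcon
  obtain ⟨⟨y, ⟨hpy, hyL⟩, hqy⟩, z, ⟨hqz, hzL⟩, hpz⟩ := hcon
  have hyz : Δ.Adj y z := hL hyL hzL (by grind)
  -- `p` and `z` are common neighbours of the nonadjacent vertices `y` and `q`.
  have := @hΔ.isClique y q (by grind) (by grind [Δ.adj_comm]) p
    (by grind [mem_commonNeighbors, Δ.adj_comm]) z (by grind [mem_commonNeighbors, Δ.adj_comm])
  grind

theorem HasCliqueCommonNeighbors.inter_subset_of_card_le (hΔ : HasCliqueCommonNeighbors Δ μ)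
    (hL : Δ.IsClique L) (hpq : p = q ∨ Δ.Adj p q) (hp : p ∉ L) (hq : q ∉ L)
    (hcard : #(Δ.neighborFinset p ∩ L) ≤ #(Δ.neighborFinset q ∩ L)) :
    Δ.neighborFinset p ∩ L ⊆ Δ.neighborFinset q ∩ L := by
  obtain rfl | hpq := hpq
  · rfl
  obtain hsub | hsub := hΔ.inter_subset_or_inter_subset hL hpq hp hq
  · exact hsub
  · exact (eq_of_subset_of_card_le hsub hcard).superset

theorem HasCliqueCommonNeighbors.exists_least_inter (hΔ : HasCliqueCommonNeighbors Δ μ)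
    (hK : Δ.IsClique K) (hL : Δ.IsClique L) (hKL : Disjoint K L) (hne : K.Nonempty) :
    ∃ p ∈ K, ∀ q ∈ K, Δ.neighborFinset p ∩ L ⊆ Δ.neighborFinset q ∩ L := by
  obtain ⟨p, hp, hmin⟩ := exists_min_image K (fun p ↦ #(Δ.neighborFinset p ∩ L)) hne
  exact ⟨p, hp, fun q hq ↦ hΔ.inter_subset_of_card_le hL (or_iff_not_imp_left.2 (hK hp hq))
    (disjoint_left.1 hKL hp) (disjoint_left.1 hKL hq) (hmin q hq)⟩

theorem HasCliqueCommonNeighbors.exists_greatest_inter (hΔ : HasCliqueCommonNeighbors Δ μ)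
    (hK : Δ.IsClique K) (hL : Δ.IsClique L) (hKL : Disjoint K L) (hne : K.Nonempty) :
    ∃ p ∈ K, ∀ q ∈ K, Δ.neighborFinset q ∩ L ⊆ Δ.neighborFinset p ∩ L := by
  obtain ⟨p, hp, hmax⟩ := exists_max_image K (fun p ↦ #(Δ.neighborFinset p ∩ L)) hne
  exact ⟨p, hp, fun q hq ↦ hΔ.inter_subset_of_card_le hL (or_iff_not_imp_left.2 (hK hq hp))
    (disjoint_left.1 hKL hq) (disjoint_left.1 hKL hp) (hmax q hq)⟩

end Traces

section MaximalClique

variable [DecidableEq W] {L : Finset W} {v w : W}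

theorem HasCliqueCommonNeighbors.card_neighborFinset_inter_le_of_maximal
    (hΔ : HasCliqueCommonNeighbors Δ μ) (hL : Maximal Δ.IsClique (L : Set W)) (hw : w ∉ L) :
    #(Δ.neighborFinset w ∩ L) ≤ μ := by
  obtain ⟨z, hz, hwz⟩ := exists_not_adj_of_maximal_isClique hL hw
  rw [← hΔ.card_neighborFinset_inter (ne_of_mem_of_not_mem hz hw).symm hwz]
  refine card_le_card fun p hp ↦ ?_
  simp only [mem_inter, mem_neighborFinset] at hp ⊢
  exact ⟨hp.1, hL.prop hz hp.2 fun h ↦ hwz (h ▸ hp.1)⟩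

-- Otherwise each of the more than `n * μ` nonneighbours `z` of `w` in `L` has a common neighbour
-- with `w` outside `L`, and more than `μ` of these `z` see the same one by nestedness.
theorem HasCliqueCommonNeighbors.card_neighborFinset_inter_eq_of_maximal
    (hΔ : HasCliqueCommonNeighbors Δ μ) (hcover : CoveredByCliques Δ (Δ.neighborFinset w) n)
    (hL : Maximal Δ.IsClique (L : Set W)) (hcard : (n + 1) * μ < #L) (hw : w ∉ L) :
    #(Δ.neighborFinset w ∩ L) = μ := by
  refine (hΔ.card_neighborFinset_inter_le_of_maximal hL hw).antisymm ?_
  by_contra! hlt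
  obtain ⟨𝒦, h𝒦, hclique, hcover⟩ := hcover
  have hsplit : #(L \ Δ.neighborFinset w) + #(Δ.neighborFinset w ∩ L) = #L := by
    rw [inter_comm, card_sdiff_add_card_inter]
  have houtside : ∀ z ∈ L \ Δ.neighborFinset w, ∃ K ∈ 𝒦, ∃ p ∈ K \ L, Δ.Adj p z := by
    intro z hz
    simp only [mem_sdiff, mem_neighborFinset] at hz
    have hcommon := hΔ.card_neighborFinset_inter (ne_of_mem_of_not_mem hz.1 hw).symm hz.2
    obtain ⟨p, hp, hpL⟩ : ∃ p ∈ Δ.neighborFinset w ∩ Δ.neighborFinset z, p ∉ L := by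
      by_contra! hsub
      have := card_le_card (subset_inter (inter_subset_left (s₂ := Δ.neighborFinset z)) hsub)
      omega
    simp only [mem_inter, mem_neighborFinset] at hp
    obtain ⟨K, hK, hpK⟩ := hcover p (by simpa using hp.1)
    exact ⟨K, hK, p, mem_sdiff.2 ⟨hpK, hpL⟩, hp.2.symm⟩
  have hne : (L \ Δ.neighborFinset w).Nonempty := card_pos.1 (by nlinarith)
  obtain ⟨K, hK, hfiber⟩ := exists_card_le_card_mul_card_filter hne houtside
  have hfiber_le : #{z ∈ L \ Δ.neighborFinset w | ∃ p ∈ K \ L, Δ.Adj p z} ≤ μ := by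
    obtain hempty | hne := (K \ L).eq_empty_or_nonempty
    · simp [hempty]
    obtain ⟨p, hp, hgreatest⟩ := hΔ.exists_greatest_inter
      ((hclique K hK).subset (coe_subset.2 sdiff_subset)) hL.prop sdiff_disjoint hne
    refine le_trans (card_le_card fun z hz ↦ ?_)
      (hΔ.card_neighborFinset_inter_le_of_maximal hL (mem_sdiff.1 hp).2)
    simp only [mem_filter, mem_sdiff (s := L)] at hz
    obtain ⟨⟨hzL, -⟩, q, hq, hqz⟩ := hz
    exact hgreatest q hq (by simp [hqz, hzL])
  have := Nat.mul_le_mul h𝒦 hfiber_le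
  nlinarith

theorem HasCliqueCommonNeighbors.inter_eq_inter_of_adj (hΔ : HasCliqueCommonNeighbors Δ μ)
    (hL : Δ.IsClique L) (htrace : ∀ w ∉ L, #(Δ.neighborFinset w ∩ L) = μ) (hv : v ∉ L) (hw : w ∉ L)
    (hvw : Δ.Adj v w) : Δ.neighborFinset v ∩ L = Δ.neighborFinset w ∩ L :=
  eq_of_subset_of_card_le
    (hΔ.inter_subset_of_card_le hL (.inr hvw) hv hw (htrace v hv ▸ (htrace w hw).ge))
    (htrace v hv ▸ (htrace w hw).le)

theorem HasCliqueCommonNeighbors.inter_eq_inter (hΔ : HasCliqueCommonNeighbors Δ μ)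
    (hL : Δ.IsClique L) (htrace : ∀ w ∉ L, #(Δ.neighborFinset w ∩ L) = μ) (hv : v ∉ L)
    (hw : w ∉ L) : Δ.neighborFinset v ∩ L = Δ.neighborFinset w ∩ L := by
  by_cases hvw : v = w
  · rw [hvw]
  by_cases hadj : Δ.Adj v w
  · exact hΔ.inter_eq_inter_of_adj hL htrace hv hw hadj
  by_cases hsub : Δ.neighborFinset v ∩ Δ.neighborFinset w ⊆ L
  · have hcommon := hΔ.card_neighborFinset_inter hvw hadj
    have hv_eq := eq_of_subset_of_card_le (subset_inter inter_subset_left hsub)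
      (by rw [htrace v hv, hcommon])
    have hw_eq := eq_of_subset_of_card_le (subset_inter inter_subset_right hsub)
      (by rw [htrace w hw, hcommon])
    rw [← hv_eq, ← hw_eq]
  · obtain ⟨p, hp, hpL⟩ := not_subset.1 hsub
    simp only [mem_inter, mem_neighborFinset] at hp
    exact (hΔ.inter_eq_inter_of_adj hL htrace hv hpL hp.1).trans
      (hΔ.inter_eq_inter_of_adj hL htrace hw hpL hp.2).symm

end MaximalClique

section DegreeBound

variable {a : ℕ}

-- A neighbour in a large maximal clique `L` of one vertex outside `L` is a neighbour of all of
-- them, hence universal.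
theorem HasCliqueCommonNeighbors.card_le_of_isClique (hΔ : HasCliqueCommonNeighbors Δ μ)
    (hμ : 1 ≤ μ) (hreg : Δ.IsRegularOfDegree a) (htop : Δ ≠ ⊤)
    (hcover : ∀ w, CoveredByCliques Δ (Δ.neighborFinset w) n) {K : Finset W}
    (hK : Δ.IsClique K) : #K ≤ (n + 1) * μ := by
  classical
  obtain ⟨L, hKL, hL⟩ := Finite.exists_le_maximal hK
  lift L to Finset W using L.toFinite
  refine (card_le_card hKL).trans ?_
  by_contra! hcard
  have htrace (w : W) (hw : w ∉ L) :=
    hΔ.card_neighborFinset_inter_eq_of_maximal (hcover w) hL hcard hw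
  obtain ⟨z, hz⟩ : ∃ z, z ∉ L := by
    by_contra! huniv
    exact htop (eq_top_iff_forall_ne_adj.2 fun x y hxy ↦ hL.prop (huniv x) (huniv y) hxy)
  obtain ⟨q, hq⟩ : (Δ.neighborFinset z ∩ L).Nonempty := by
    rw [← card_pos, htrace z hz]
    exact hμ
  refine htop (eq_top_of_isUniversal (v := q) hreg fun v hqv ↦ ?_)
  by_cases hv : v ∈ L
  · exact hL.prop (mem_inter.1 hq).2 hv hqv
  · rw [hΔ.inter_eq_inter hL.prop htrace hz hv, mem_inter, mem_neighborFinset] at hq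
    exact hq.1.symm

theorem HasCliqueCommonNeighbors.degree_le (hΔ : HasCliqueCommonNeighbors Δ μ) (hμ : 1 ≤ μ)
    (hreg : Δ.IsRegularOfDegree a) (htop : Δ ≠ ⊤)
    (hcover : ∀ w, CoveredByCliques Δ (Δ.neighborFinset w) n) :
    a ≤ n * (n + 1) * μ := by
  obtain ⟨w, -⟩ := ne_top_iff_exists_not_adj.1 htop
  obtain ⟨K, -, hK, hle⟩ := (hcover w).exists_isClique_card_le
  rw [card_neighborFinset_eq_degree, hreg.degree_eq] at hle
  have := hΔ.card_le_of_isClique hμ hreg htop hcover hK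
  nlinarith

end DegreeBound

end CliqueCommonNeighbors

section PosSemidef

theorem sum_sum_mul_nonneg_of_posSemidef {W ι : Type*} [Finite W] [Fintype ι]
    {M : Matrix W W ℝ} (hM : M.PosSemidef) (S : ι → Finset W) (r : ι → ℝ) :
    0 ≤ ∑ i, ∑ j, r i * r j * ∑ u ∈ S i, ∑ v ∈ S j, M u v := by
  classical
  cases nonempty_fintype W
  let B : Matrix W ι ℝ := .of fun v i ↦ if v ∈ S i then 1 else 0
  have hentry (i j : ι) : (B.conjTranspose * M * B) i j = ∑ u ∈ S i, ∑ v ∈ S j, M u v := by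
    simp only [B, Matrix.mul_apply, Matrix.conjTranspose_apply, Matrix.of_apply, star_trivial,
      ite_mul, mul_ite, one_mul, mul_one, zero_mul, mul_zero, sum_ite_mem, univ_inter]
    exact sum_comm
  have hform := (hM.conjTranspose_mul_mul_same B).dotProduct_mulVec_nonneg r
  simp only [dotProduct, Matrix.mulVec, hentry, star_trivial, mul_sum] at hform
  refine hform.trans_eq (sum_congr rfl fun i _ ↦ sum_congr rfl fun j _ ↦ ?_)
  ring

variable {W : Type*} [DecidableEq W] {Δ : SimpleGraph W} [DecidableRel Δ.Adj] {m n : ℕ}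
  {S T : Finset W}

theorem sum_sum_adjMatrix_add_smul_one_of_isClique (hS : Δ.IsClique S) :
    ∑ u ∈ S, ∑ v ∈ S, (Δ.adjMatrix ℝ + (m : ℝ) • 1) u v = #S * (#S + m - 1) := by
  calc ∑ u ∈ S, ∑ v ∈ S, (Δ.adjMatrix ℝ + (m : ℝ) • 1) u v
      = ∑ u ∈ S, ∑ v ∈ S, (1 + if u = v then (m - 1 : ℝ) else 0) := by
        refine sum_congr rfl fun u hu ↦ sum_congr rfl fun v hv ↦ ?_
        by_cases huv : u = v
        · simp [huv]
        · simp [huv, hS hu hv huv]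
    _ = #S * (#S + m - 1) := by
      simp [sum_add_distrib]
      ring

theorem sum_sum_adjMatrix_add_smul_one_of_isIndepSet (hS : Δ.IsIndepSet S) :
    ∑ u ∈ S, ∑ v ∈ S, (Δ.adjMatrix ℝ + (m : ℝ) • 1) u v = #S * m := by
  calc ∑ u ∈ S, ∑ v ∈ S, (Δ.adjMatrix ℝ + (m : ℝ) • 1) u v
      = ∑ u ∈ S, ∑ v ∈ S, (if u = v then (m : ℝ) else 0) := by
        refine sum_congr rfl fun u hu ↦ sum_congr rfl fun v hv ↦ ?_
        by_cases huv : u = v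
        · simp [huv]
        · simp [huv, hS hu hv huv]
    _ = #S * m := by simp

theorem sum_sum_adjMatrix_add_smul_one_of_forall_adj (hST : ∀ u ∈ S, ∀ v ∈ T, Δ.Adj u v) :
    ∑ u ∈ S, ∑ v ∈ T, (Δ.adjMatrix ℝ + (m : ℝ) • 1) u v = #S * #T := by
  calc ∑ u ∈ S, ∑ v ∈ T, (Δ.adjMatrix ℝ + (m : ℝ) • 1) u v
      = ∑ u ∈ S, ∑ v ∈ T, 1 :=
        sum_congr rfl fun u hu ↦ sum_congr rfl fun v hv ↦ by
          simp [hST u hu v hv, (hST u hu v hv).ne]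
    _ = #S * #T := by simp

theorem sum_sum_adjMatrix_add_smul_one_of_forall_not_adj
    (hST : ∀ u ∈ S, ∀ v ∈ T, u ≠ v ∧ ¬Δ.Adj u v) :
    ∑ u ∈ S, ∑ v ∈ T, (Δ.adjMatrix ℝ + (m : ℝ) • 1) u v = 0 :=
  sum_eq_zero fun u hu ↦ sum_eq_zero fun v hv ↦ by simp [hST u hu v hv]

theorem card_le_sq_of_isIndepSet [Fintype W] (hm : 1 ≤ m)
    (hpsd : (Δ.adjMatrix ℝ + (m : ℝ) • 1).PosSemidef) {y : W} {I : Finset W}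
    (hIy : I ⊆ Δ.neighborFinset y) (hI : Δ.IsIndepSet I) : #I ≤ m ^ 2 := by
  have hadj (v : W) (hv : v ∈ I) : Δ.Adj y v := by simpa using hIy hv
  have hform := sum_sum_mul_nonneg_of_posSemidef hpsd ![{y}, I] ![m, -1]
  have hy : Δ.IsIndepSet ({y} : Finset W) := by simp
  simp only [Fin.sum_univ_two, Matrix.cons_val_zero, Matrix.cons_val_one,
    sum_sum_adjMatrix_add_smul_one_of_isIndepSet hy,
    sum_sum_adjMatrix_add_smul_one_of_isIndepSet hI,
    sum_sum_adjMatrix_add_smul_one_of_forall_adj (S := {y}) (T := I) (by simpa using hadj),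
    sum_sum_adjMatrix_add_smul_one_of_forall_adj (S := I) (T := {y})
      (by simpa using fun v hv ↦ (hadj v hv).symm), card_singleton] at hform
  have : (0 : ℝ) ≤ m * (m ^ 2 - #I) := by push_cast at hform; linarith
  have := nonneg_of_mul_nonneg_right this (by positivity)
  exact_mod_cast sub_nonneg.1 this

-- The weights `2`, `2`, `-3` on cliques `Y`, `Z`, `S` of size `n` give `17 (m - 1) n - 7 n ^ 2`.
theorem le_three_mul_of_forall_adj [Finite W]
    (hpsd : (Δ.adjMatrix ℝ + (m : ℝ) • 1).PosSemidef) {Y Z S : Finset W}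
    (hY : Δ.IsClique Y) (hZ : Δ.IsClique Z) (hS : Δ.IsClique S)
    (hYZ : ∀ y ∈ Y, ∀ z ∈ Z, y ≠ z ∧ ¬Δ.Adj y z) (hYS : ∀ y ∈ Y, ∀ s ∈ S, Δ.Adj y s)
    (hZS : ∀ z ∈ Z, ∀ s ∈ S, Δ.Adj z s) (hnY : n ≤ #Y) (hnZ : n ≤ #Z) (hnS : n ≤ #S) :
    n ≤ 3 * m := by
  obtain ⟨Y', hY', hcardY⟩ := exists_subset_card_eq hnY
  obtain ⟨Z', hZ', hcardZ⟩ := exists_subset_card_eq hnZ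
  obtain ⟨S', hS', hcardS⟩ := exists_subset_card_eq hnS
  replace hY := hY.subset (coe_subset.2 hY')
  replace hZ := hZ.subset (coe_subset.2 hZ')
  replace hS := hS.subset (coe_subset.2 hS')
  replace hYZ y (hy : y ∈ Y') z (hz : z ∈ Z') := hYZ y (hY' hy) z (hZ' hz)
  replace hYS y (hy : y ∈ Y') s (hs : s ∈ S') := hYS y (hY' hy) s (hS' hs)
  replace hZS z (hz : z ∈ Z') s (hs : s ∈ S') := hZS z (hZ' hz) s (hS' hs)
  have hform := sum_sum_mul_nonneg_of_posSemidef hpsd ![Y', Z', S'] ![2, 2, -3]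
  simp only [Fin.sum_univ_three, Matrix.cons_val_zero, Matrix.cons_val_one, Matrix.cons_val,
    sum_sum_adjMatrix_add_smul_one_of_isClique hY, sum_sum_adjMatrix_add_smul_one_of_isClique hZ,
    sum_sum_adjMatrix_add_smul_one_of_isClique hS,
    sum_sum_adjMatrix_add_smul_one_of_forall_not_adj hYZ,
    sum_sum_adjMatrix_add_smul_one_of_forall_not_adj (S := Z') (T := Y')
      fun z hz y hy ↦ ⟨(hYZ y hy z hz).1.symm, mt Adj.symm (hYZ y hy z hz).2⟩,
    sum_sum_adjMatrix_add_smul_one_of_forall_adj hYS,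
    sum_sum_adjMatrix_add_smul_one_of_forall_adj (S := S') (T := Y')
      fun s hs y hy ↦ (hYS y hy s hs).symm,
    sum_sum_adjMatrix_add_smul_one_of_forall_adj hZS,
    sum_sum_adjMatrix_add_smul_one_of_forall_adj (S := S') (T := Z')
      fun s hs z hz ↦ (hZS z hz s hs).symm, hcardY, hcardZ, hcardS] at hform
  by_contra! hlt
  have : (3 * m + 1 : ℝ) ≤ n := by exact_mod_cast hlt
  nlinarith

end PosSemidef

section CardBound

variable {W : Type*} [Fintype W] {Δ : SimpleGraph W} {μ a d M N : ℕ}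

theorem HasCliqueCommonNeighbors.exists_forall_not_adj
    [Nonempty W] [DecidableEq W] [DecidableRel Δ.Adj]
    (hΔ : HasCliqueCommonNeighbors Δ μ) (hcover : CoveredByCliques Δ univ N) (hd : 0 < d)
    (hdeg : ∀ y, d ≤ Δᶜ.degree y) :
    ∃ Y Z : Finset W, Δ.IsClique Y ∧ Δ.IsClique Z ∧ (∀ y ∈ Y, ∀ z ∈ Z, y ≠ z ∧ ¬Δ.Adj y z) ∧
      Fintype.card W ≤ N ^ 2 * #Y ∧ d ≤ N * #Z := by
  have ⟨𝒦, h𝒦, hclique, hmem⟩ := hcover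
  have hnonadj (y : W) : ∃ L ∈ 𝒦, d ≤ N * #{z ∈ Δᶜ.neighborFinset y | z ∈ L} := by
    obtain ⟨L, hL, hle⟩ := exists_card_le_card_mul_card_filter
      (card_pos.1 (hd.trans_le (hdeg y))) (fun z _ ↦ hmem z (mem_univ z))
    exact ⟨L, hL, (hdeg y).trans (hle.trans (Nat.mul_le_mul_right _ h𝒦))⟩
  obtain ⟨L, hL, hfiber⟩ :=
    exists_card_le_card_mul_card_filter (s := univ) univ_nonempty fun y _ ↦ hnonadj y
  obtain ⟨Y, hYL, hY, hYcard⟩ := (hcover.mono (subset_univ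
    {y | d ≤ N * #{z ∈ Δᶜ.neighborFinset y | z ∈ L}})).exists_isClique_card_le
  replace hYcard : Fintype.card W ≤ N ^ 2 * #Y := by
    calc Fintype.card W ≤ #𝒦 * #{y | d ≤ N * #{z ∈ Δᶜ.neighborFinset y | z ∈ L}} := hfiber
      _ ≤ N * (N * #Y) := Nat.mul_le_mul h𝒦 hYcard
      _ = N ^ 2 * #Y := by ring
  replace hYL (y : W) (hy : y ∈ Y) : d ≤ N * #{z ∈ Δᶜ.neighborFinset y | z ∈ L} := by
    simpa using hYL hy
  have hdisj : Disjoint Y L := disjoint_left.2 fun y hy hyL ↦ by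
    have hempty : {z ∈ Δᶜ.neighborFinset y | z ∈ L} = ∅ := filter_eq_empty_iff.2 fun z hz hzL ↦ by
      rw [mem_neighborFinset, compl_adj] at hz
      exact hz.2 (hclique L hL hyL hzL hz.1)
    have := hYL y hy
    rw [hempty, card_empty] at this
    omega
  have hYne : Y.Nonempty := nonempty_iff_ne_empty.2 fun h ↦ by
    simp [h] at hYcard
  obtain ⟨p, hp, hgreatest⟩ := hΔ.exists_greatest_inter hY (hclique L hL) hdisj hYne
  refine ⟨Y, {z ∈ Δᶜ.neighborFinset p | z ∈ L}, hY, (hclique L hL).subset fun z ↦ by simp,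
    fun y hy z hz ↦ ?_, hYcard, hYL p hp⟩
  simp only [mem_filter, mem_neighborFinset, compl_adj] at hz
  refine ⟨fun h ↦ disjoint_left.1 hdisj hy (h ▸ hz.2), fun hyz ↦ hz.1.2 ?_⟩
  simpa using mem_of_mem_inter_left (hgreatest y hy (by simp [hyz, hz.2]))

theorem HasCliqueCommonNeighbors.exists_isClique_card_common_le [DecidableRel Δ.Adj]
    (hΔ : HasCliqueCommonNeighbors Δ μ) (hμ : 0 < μ) (hcover : CoveredByCliques Δ univ N)
    {Y Z : Finset W} (hYZ : ∀ y ∈ Y, ∀ z ∈ Z, y ≠ z ∧ ¬Δ.Adj y z) (hY : Y.Nonempty)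
    (hZ : Z.Nonempty) :
    ∃ T : Finset W, Δ.IsClique T ∧ #Y ≤
      N * #{y ∈ Y | #Z ≤ N * #{z ∈ Z | μ ≤ N * #{s ∈ T | Δ.Adj y s ∧ Δ.Adj z s}}} := by
  classical
  obtain ⟨𝒦, h𝒦, hclique, hmem⟩ := hcover
  have hcommon (y z : W) (hy : y ∈ Y) (hz : z ∈ Z) :
      ∃ T ∈ 𝒦, μ ≤ N * #{s ∈ T | Δ.Adj y s ∧ Δ.Adj z s} := by
    have hcard := hΔ.card_neighborFinset_inter (hYZ y hy z hz).1 (hYZ y hy z hz).2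
    obtain ⟨T, hT, hle⟩ := exists_card_le_card_mul_card_filter (card_pos.1 (hcard ▸ hμ))
      (fun s _ ↦ hmem s (mem_univ s))
    refine ⟨T, hT, hcard ▸ hle.trans (Nat.mul_le_mul h𝒦 (card_le_card fun s hs ↦ ?_))⟩
    simpa [and_comm, and_assoc] using hs
  have hfiber (y : W) (hy : y ∈ Y) :
      ∃ T ∈ 𝒦, #Z ≤ N * #{z ∈ Z | μ ≤ N * #{s ∈ T | Δ.Adj y s ∧ Δ.Adj z s}} := by
    obtain ⟨T, hT, hle⟩ := exists_card_le_card_mul_card_filter hZ fun z hz ↦ hcommon y z hy hz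
    exact ⟨T, hT, hle.trans (Nat.mul_le_mul_right _ h𝒦)⟩
  obtain ⟨T, hT, hle⟩ := exists_card_le_card_mul_card_filter hY hfiber
  exact ⟨T, hclique T hT, hle.trans (Nat.mul_le_mul_right _ h𝒦)⟩

-- By nestedness, what the least `y` and the least `z` see of the clique `T` outside `Y ∪ Z` is seen
-- by all of `Y'` and `Z'`.
theorem HasCliqueCommonNeighbors.exists_forall_adj
    (hΔ : HasCliqueCommonNeighbors Δ μ) (hμ : 0 < μ) (hcover : CoveredByCliques Δ univ N)
    {Y Z : Finset W} (hY : Δ.IsClique Y) (hZ : Δ.IsClique Z)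
    (hYZ : ∀ y ∈ Y, ∀ z ∈ Z, y ≠ z ∧ ¬Δ.Adj y z) (hYne : Y.Nonempty) (hZne : Z.Nonempty) :
    ∃ Y' ⊆ Y, ∃ Z' ⊆ Z, ∃ S : Finset W, Δ.IsClique S ∧ (∀ y ∈ Y', ∀ s ∈ S, Δ.Adj y s) ∧
      (∀ z ∈ Z', ∀ s ∈ S, Δ.Adj z s) ∧ #Y ≤ N * #Y' ∧ #Z ≤ N * #Z' ∧ μ ≤ N * #S := by
  classical
  obtain ⟨T, hT, hYcard⟩ := hΔ.exists_isClique_card_common_le hμ hcover hYZ hYne hZne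
  let Z' : W → Finset W := fun y ↦ {z ∈ Z | μ ≤ N * #{s ∈ T | Δ.Adj y s ∧ Δ.Adj z s}}
  let Y' : Finset W := {y ∈ Y | #Z ≤ N * #(Z' y)}
  let L : Finset W := {s ∈ T | s ∉ Y ∧ s ∉ Z}
  have hL : Δ.IsClique L := hT.subset (coe_subset.2 (filter_subset _ _))
  have hY'Y : Y' ⊆ Y := filter_subset _ _
  have hZ'Z (y : W) : Z' y ⊆ Z := filter_subset _ _
  obtain ⟨y, hy, hy_least⟩ := hΔ.exists_least_inter (hY.subset (coe_subset.2 hY'Y)) hL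
    (disjoint_left.2 fun s hs hsL ↦ by grind)
    (card_pos.1 (Nat.pos_of_mul_pos_left (hYne.card_pos.trans_le hYcard)))
  have hZcard : #Z ≤ N * #(Z' y) := (mem_filter.1 hy).2
  obtain ⟨z, hz, hz_least⟩ := hΔ.exists_least_inter (hZ.subset (coe_subset.2 (hZ'Z y))) hL
    (disjoint_left.2 fun s hs hsL ↦ by grind)
    (card_pos.1 (Nat.pos_of_mul_pos_left (hZne.card_pos.trans_le hZcard)))
  have hmem_L (s : W) (hs : s ∈ T) (hys : Δ.Adj y s) (hzs : Δ.Adj z s) : s ∈ L :=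
    mem_filter.2 ⟨hs, fun hsY ↦ (hYZ s hsY z (hZ'Z y hz)).2 hzs.symm,
      fun hsZ ↦ (hYZ y (hY'Y hy) s hsZ).2 hys⟩
  refine ⟨Y', hY'Y, Z' y, hZ'Z y, {s ∈ T | Δ.Adj y s ∧ Δ.Adj z s},
    hT.subset (coe_subset.2 (filter_subset _ _)), fun v hv s hs ↦ ?_, fun v hv s hs ↦ ?_, hYcard,
    hZcard, (mem_filter.1 hz).2⟩
  all_goals
    obtain ⟨hsT, hys, hzs⟩ := mem_filter.1 hs
    have hsL := hmem_L s hsT hys hzs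
  · simpa using mem_of_mem_inter_left (hy_least v hv (by simp [hys, hsL]))
  · simpa using mem_of_mem_inter_left (hz_least v hv (by simp [hzs, hsL]))

variable [DecidableRel Δ.Adj]

theorem card_mul_le_of_isIndepSet [DecidableEq W] (hreg : Δ.IsRegularOfDegree a) {I : Finset W}
    (hI : Δ.IsIndepSet I) (hM : ∀ w, #(Δ.neighborFinset w ∩ I) ≤ M) : #I * a ≤ #Iᶜ * M := by
  refine card_mul_le_card_mul Δ.Adj (fun v hv ↦ ?_) fun w _ ↦ ?_
  · rw [← hreg.degree_eq v, ← card_neighborFinset_eq_degree]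
    refine card_le_card fun w hw ↦ ?_
    have hvw : Δ.Adj v w := by simpa using hw
    simp only [mem_bipartiteAbove, mem_compl]
    exact ⟨fun hwI ↦ hI hv hwI hvw.ne hvw, hvw⟩
  · refine le_trans (card_le_card fun v hv ↦ ?_) (hM w)
    simpa [Δ.adj_comm w, and_comm] using hv

theorem degree_compl_pos [DecidableEq W] (hreg : Δ.IsRegularOfDegree a) (htop : Δ ≠ ⊤) (y : W) :
    0 < Δᶜ.degree y := by
  obtain ⟨u, v, huv, hadj⟩ := ne_top_iff_exists_not_adj.1 htop
  rw [hreg.compl.degree_eq, ← hreg.compl.degree_eq u, degree_pos_iff_exists_adj]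
  exact ⟨v, huv, hadj⟩

theorem two_mul_card_le_of_isClique (hreg : Δ.IsRegularOfDegree a) (htop : Δ ≠ ⊤) {K : Finset W}
    (hK : Δ.IsClique K) : 2 * #K ≤ Fintype.card W := by
  classical
  obtain rfl | ⟨y, -⟩ := K.eq_empty_or_nonempty
  · simp
  have hpos := degree_compl_pos hreg htop y
  rw [hreg.compl.degree_eq] at hpos
  have hle := card_mul_le_of_isIndepSet hreg.compl ((isIndepSet_compl Δ).2 hK) fun w ↦
    (card_le_card inter_subset_left).trans (hreg.compl.degree_eq w).le
  have := Nat.le_of_mul_le_mul_right hle hpos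
  have := card_add_card_compl K
  omega

theorem HasCliqueCommonNeighbors.degree_compl_mul_le [DecidableEq W]
    (hΔ : HasCliqueCommonNeighbors Δ μ) (hreg : Δ.IsRegularOfDegree a) (y : W) :
    Δᶜ.degree y * μ ≤ a * a := by
  nth_rw 1 [← hreg.degree_eq y]
  rw [← card_neighborFinset_eq_degree, ← card_neighborFinset_eq_degree]
  refine card_mul_le_card_mul Δ.Adj (fun z hz ↦ ?_) fun w _ ↦ ?_
  · simp only [mem_neighborFinset, compl_adj] at hz
    rw [← hΔ.card_neighborFinset_inter hz.1 hz.2]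
    exact card_le_card fun w hw ↦ by simpa using hw
  · rw [← hreg.degree_eq w, ← card_neighborFinset_eq_degree]
    exact card_le_card fun z hz ↦ by simpa [Δ.adj_comm w] using (mem_bipartiteBelow _ |>.1 hz).2

theorem HasCliqueCommonNeighbors.card_le_four_mul_degree_compl [DecidableEq W]
    (hΔ : HasCliqueCommonNeighbors Δ μ) (hreg : Δ.IsRegularOfDegree a) (htop : Δ ≠ ⊤) (y : W) :
    Fintype.card W ≤ 4 * Δᶜ.degree y := by
  obtain ⟨u, v, huv, hadj⟩ := ne_top_iff_exists_not_adj.1 htop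
  have hcommon : 2 * μ ≤ Fintype.card W :=
    hΔ.card_neighborFinset_inter huv hadj ▸
      two_mul_card_le_of_isClique hreg htop (hΔ.isClique_neighborFinset_inter huv hadj)
  have hunion : #(Δ.neighborFinset u ∪ Δ.neighborFinset v) + 2 ≤ Fintype.card W := by
    rw [← card_pair huv, ← card_union_of_disjoint]
    · exact card_le_univ _
    · simp [hadj, Δ.adj_comm v]
  have hsum := card_union_add_card_inter (Δ.neighborFinset u) (Δ.neighborFinset v)
  rw [hΔ.card_neighborFinset_inter huv hadj, card_neighborFinset_eq_degree,
    card_neighborFinset_eq_degree, hreg.degree_eq, hreg.degree_eq] at hsum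
  rw [hreg.compl.degree_eq]
  omega

/-- Bound for the ratio of the degree to `μ`, for a graph without independent sets of more than `n`
vertices in the neighbourhood of a vertex. -/
def degreeRatio (n : ℕ) : ℕ := n ^ 2 * (n ^ 2 + 1)

/-- Bound for the ratio of the number of vertices to `μ`, with `n` as in `degreeRatio`. -/
def cardRatio (n : ℕ) : ℕ := 1 + degreeRatio n + degreeRatio n ^ 2

/-- Bound for the number of cliques needed to cover all vertices, with `n` as in `degreeRatio`. -/
def coverBound (n : ℕ) : ℕ := (n * cardRatio n) ^ 2

/-- Bound for the number of vertices of a non-complete regular graph with all eigenvalues at least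
`-m` and clique common neighbours, see `HasCliqueCommonNeighbors.card_le_cardBound`. -/
def cardBound (m : ℕ) : ℕ :=
  (coverBound (m ^ 2) ^ 3 + 4 * coverBound (m ^ 2) ^ 2 +
    cardRatio (m ^ 2) * coverBound (m ^ 2)) * (3 * m)

section ClawBound

variable {n : ℕ} (hΔ : HasCliqueCommonNeighbors Δ μ) (hμ : 0 < μ)
  (hreg : Δ.IsRegularOfDegree a) (htop : Δ ≠ ⊤)
  (hclaw : ∀ w, ∀ I ⊆ Δ.neighborFinset w, Δ.IsIndepSet I → #I ≤ n)

include hΔ hμ hreg htop hclaw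

theorem HasCliqueCommonNeighbors.degree_le_degreeRatio_mul : a ≤ degreeRatio n * μ :=
  hΔ.degree_le hμ hreg htop fun w ↦ hΔ.coveredByCliques (hclaw w)

theorem HasCliqueCommonNeighbors.card_le_cardRatio_mul : Fintype.card W ≤ cardRatio n * μ := by
  classical
  obtain ⟨y, -⟩ := ne_top_iff_exists_not_adj.1 htop
  have ha := hΔ.degree_le_degreeRatio_mul hμ hreg htop hclaw
  have hcompl : Fintype.card W - 1 - a ≤ degreeRatio n ^ 2 * μ := by
    refine Nat.le_of_mul_le_mul_right ?_ hμ
    calc (Fintype.card W - 1 - a) * μ = Δᶜ.degree y * μ := by rw [hreg.compl.degree_eq]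
      _ ≤ a * a := hΔ.degree_compl_mul_le hreg y
      _ ≤ (degreeRatio n * μ) * (degreeRatio n * μ) := Nat.mul_le_mul ha ha
      _ = degreeRatio n ^ 2 * μ * μ := by ring
  have hratio : cardRatio n * μ = μ + degreeRatio n * μ + degreeRatio n ^ 2 * μ := by
    rw [cardRatio]
    ring
  omega

theorem HasCliqueCommonNeighbors.coveredByCliques_univ :
    CoveredByCliques Δ univ (coverBound n) := by
  classical
  obtain ⟨y, z, hyz, hadj⟩ := ne_top_iff_exists_not_adj.1 htop
  have hμa : μ ≤ a := by
    rw [← hΔ.card_neighborFinset_inter hyz hadj, ← hreg.degree_eq y,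
      ← card_neighborFinset_eq_degree]
    exact card_le_card inter_subset_left
  refine hΔ.coveredByCliques fun I _ hI ↦ Nat.le_of_mul_le_mul_right ?_ (hμ.trans_le hμa)
  calc #I * a ≤ #Iᶜ * n := card_mul_le_of_isIndepSet hreg hI fun w ↦
        hclaw w _ inter_subset_left (Set.Pairwise.mono (coe_subset.2 inter_subset_right) hI)
    _ ≤ cardRatio n * a * n := by
      gcongr
      exact (card_le_univ _).trans
        ((hΔ.card_le_cardRatio_mul hμ hreg htop hclaw).trans (Nat.mul_le_mul_left _ hμa))
    _ = n * cardRatio n * a := by ring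

theorem HasCliqueCommonNeighbors.exists_joined_cliques :
    ∃ Y Z S : Finset W, (Δ.IsClique Y ∧ Δ.IsClique Z ∧ Δ.IsClique S) ∧
      (∀ y ∈ Y, ∀ z ∈ Z, y ≠ z ∧ ¬Δ.Adj y z) ∧ (∀ y ∈ Y, ∀ s ∈ S, Δ.Adj y s) ∧
      (∀ z ∈ Z, ∀ s ∈ S, Δ.Adj z s) ∧ Fintype.card W ≤ coverBound n ^ 3 * #Y ∧
      Fintype.card W ≤ 4 * coverBound n ^ 2 * #Z ∧
      Fintype.card W ≤ cardRatio n * coverBound n * #S := by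
  classical
  obtain ⟨y, -⟩ := ne_top_iff_exists_not_adj.1 htop
  have : Nonempty W := ⟨y⟩
  have hcover := hΔ.coveredByCliques_univ hμ hreg htop hclaw
  have hpos := degree_compl_pos hreg htop y
  obtain ⟨Y, Z, hY, hZ, hYZ, hYcard, hZcard⟩ := hΔ.exists_forall_not_adj hcover hpos fun z ↦ by
    rw [hreg.compl.degree_eq, hreg.compl.degree_eq]
  obtain ⟨Y', hY'Y, Z', hZ'Z, S, hS, hYS, hZS, hY'card, hZ'card, hScard⟩ :=
    hΔ.exists_forall_adj hμ hcover hY hZ hYZ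
      (card_pos.1 (Nat.pos_of_mul_pos_left (Fintype.card_pos.trans_le hYcard)))
      (card_pos.1 (Nat.pos_of_mul_pos_left (hpos.trans_le hZcard)))
  refine ⟨Y', Z', S, ⟨hY.subset (coe_subset.2 hY'Y), hZ.subset (coe_subset.2 hZ'Z), hS⟩,
    fun y hy z hz ↦ hYZ y (hY'Y hy) z (hZ'Z hz), hYS, hZS, ?_, ?_, ?_⟩
  · calc Fintype.card W ≤ coverBound n ^ 2 * #Y := hYcard
      _ ≤ coverBound n ^ 2 * (coverBound n * #Y') := by gcongr
      _ = coverBound n ^ 3 * #Y' := by ring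
  · calc Fintype.card W ≤ 4 * Δᶜ.degree y := hΔ.card_le_four_mul_degree_compl hreg htop y
      _ ≤ 4 * (coverBound n * #Z) := by gcongr
      _ ≤ 4 * (coverBound n * (coverBound n * #Z')) := by gcongr
      _ = 4 * coverBound n ^ 2 * #Z' := by ring
  · calc Fintype.card W ≤ cardRatio n * μ := hΔ.card_le_cardRatio_mul hμ hreg htop hclaw
      _ ≤ cardRatio n * (coverBound n * #S) := by gcongr
      _ = cardRatio n * coverBound n * #S := by ring

end ClawBound

theorem HasCliqueCommonNeighbors.card_le_cardBound [DecidableEq W]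
    (hΔ : HasCliqueCommonNeighbors Δ μ) (hμ : 0 < μ) (hreg : Δ.IsRegularOfDegree a)
    (htop : Δ ≠ ⊤) {m : ℕ} (hm : 1 ≤ m)
    (hpsd : (Δ.adjMatrix ℝ + (m : ℝ) • 1).PosSemidef) : Fintype.card W ≤ cardBound m := by
  obtain ⟨Y, Z, S, ⟨hY, hZ, hS⟩, hYZ, hYS, hZS, hYcard, hZcard, hScard⟩ :=
    hΔ.exists_joined_cliques hμ hreg htop fun _ _ hIw hI ↦ card_le_sq_of_isIndepSet hm hpsd hIw hI
  have hmin := le_three_mul_of_forall_adj (n := min #Y (min #Z #S)) hpsd hY hZ hS hYZ hYS hZS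
    (by omega) (by omega) (by omega)
  refine le_trans ?_ (Nat.mul_le_mul_left _ hmin)
  rw [add_mul, add_mul]
  obtain h | h | h : min #Y (min #Z #S) = #Y ∨ min #Y (min #Z #S) = #Z ∨
      min #Y (min #Z #S) = #S := by omega
  all_goals
    rw [h]
    omega

end CardBound

section Spectral

open Polynomial

variable {V : Type*} [Fintype V] {G : SimpleGraph V} {b c : ℕ → ℕ} {θ : ℝ}

theorem isHermitian_aeval [DecidableEq V] {A : Matrix V V ℝ} (hA : A.IsHermitian) (p : ℝ[X]) :
    (aeval A p).IsHermitian := by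
  rw [aeval_eq_sum_range]
  exact isSelfAdjoint_sum _ fun i _ ↦ (IsSelfAdjoint.all _).smul (IsSelfAdjoint.pow hA i)

-- If `q` is the minimal polynomial divided by `X - θ`, then `q(A) ^ 2` has the required properties.
theorem exists_aeval_posSemidef_of_hasEigenvalue [DecidableEq V] {A : Matrix V V ℝ}
    (hA : A.IsHermitian) (hθ : Module.End.HasEigenvalue A.toLin' θ) :
    ∃ p : ℝ[X], (aeval A p).PosSemidef ∧ aeval A p ≠ 0 ∧ aeval A p * A = θ • aeval A p := by
  have hroot : (minpoly ℝ A).IsRoot θ := by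
    rw [← Matrix.minpoly_toLin']
    exact Module.End.isRoot_of_hasEigenvalue hθ
  set q := minpoly ℝ A /ₘ (X - C θ)
  have hfactor : (X - C θ) * q = minpoly ℝ A := mul_divByMonic_eq_iff_isRoot.2 hroot
  have hmin : minpoly ℝ A ≠ 0 := minpoly.ne_zero (Algebra.IsIntegral.isIntegral A)
  have hq : aeval A q ≠ 0 := fun h ↦ by
    have hq0 : q ≠ 0 := right_ne_zero_of_mul (hfactor ▸ hmin)
    have hdeg := natDegree_le_of_dvd (minpoly.dvd ℝ A h) hq0
    rw [← hfactor, natDegree_mul (X_sub_C_ne_zero θ) hq0, natDegree_X_sub_C] at hdeg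
    omega
  have hsq : aeval A (q * q) = (aeval A q).conjTranspose * aeval A q := by
    rw [map_mul, (isHermitian_aeval hA q).eq]
  refine ⟨q * q, hsq ▸ Matrix.posSemidef_conjTranspose_mul_self _,
    hsq ▸ Matrix.conjTranspose_mul_self_eq_zero.not.2 hq, ?_⟩
  have hzero : aeval A (q * q) * aeval A (X - C θ) = 0 := by
    rw [← map_mul, show q * q * (X - C θ) = q * ((X - C θ) * q) by ring, hfactor, map_mul,
      minpoly.aeval, mul_zero]
  rw [map_sub, aeval_X, aeval_C, mul_sub, sub_eq_zero] at hzero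
  rw [hzero, Algebra.smul_def, Algebra.commutes]

variable [DecidableRel G.Adj]

theorem IsEigenvalue.hasEigenvalue [DecidableEq V] (hθ : IsEigenvalue G θ) :
    Module.End.HasEigenvalue (G.adjMatrix ℝ).toLin' θ := by
  unfold IsEigenvalue at hθ
  convert hθ

theorem IsEigenvalue.le_of_isRegularOfDegree {k : ℕ} (hθ : IsEigenvalue G θ)
    (hreg : G.IsRegularOfDegree k) : θ ≤ k := by
  classical
  obtain ⟨v, hv⟩ := eigenvalue_mem_ball hθ.hasEigenvalue
  rw [Metric.mem_closedBall, Real.dist_eq, adjMatrix_apply, if_neg (G.loopless.irrefl v),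
    sub_zero] at hv
  calc θ ≤ ∑ w ∈ univ.erase v, ‖G.adjMatrix ℝ v w‖ := (le_abs_self θ).trans hv
    _ ≤ ∑ w, ‖G.adjMatrix ℝ v w‖ :=
        sum_le_sum_of_subset_of_nonneg (erase_subset _ _) fun _ _ _ ↦ norm_nonneg _
    _ = k := by
        simp [adjMatrix_apply, apply_ite norm, ← hreg.degree_eq v, ← card_neighborFinset_eq_degree,
          neighborFinset_eq_filter]

theorem sum_neighborFinset (hG : IsDistanceRegularWith G b c) (e : ℕ → ℝ) (u v : V) :
    ∑ w ∈ G.neighborFinset v, e (G.dist u w) =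
      b 0 * e (G.dist u v) + b (G.dist u v) * (e (G.dist u v + 1) - e (G.dist u v))
        + c (G.dist u v) * (e (G.dist u v - 1) - e (G.dist u v)) := by
  set i := G.dist u v with hi
  have hsplit (w : V) (hw : w ∈ G.neighborFinset v) : e (G.dist u w) = e i
      + (if G.dist u w = i + 1 then e (i + 1) - e i else 0)
      + (if G.dist u w + 1 = i then e (i - 1) - e i else 0) := by
    rcases ((mem_neighborFinset ..).1 hw).diff_dist_adj (u := u) with h | h | h <;> grind
  have hb : #{w ∈ G.neighborFinset v | G.dist u w = i + 1} = b i := by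
    rw [hi, ← hG.ncard_farther, ← Set.ncard_coe_finset]
    congr 1
    ext w
    simp [farther]
  have hc : #{w ∈ G.neighborFinset v | G.dist u w + 1 = i} = c i := by
    rw [hi, ← hG.ncard_nearer, ← Set.ncard_coe_finset]
    congr 1
    ext w
    simp [nearer]
  rw [sum_congr rfl hsplit, sum_add_distrib, sum_add_distrib, ← sum_filter, ← sum_filter,
    sum_const, sum_const, sum_const, hb, hc, card_neighborFinset_eq_degree,
    hG.isRegularOfDegree.degree_eq]
  simp only [nsmul_eq_mul]

theorem exists_aeval_apply_eq [DecidableEq V] (hG : IsDistanceRegularWith G b c) (p : ℝ[X]) :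
    ∃ e : ℕ → ℝ, ∀ u v, aeval (G.adjMatrix ℝ) p u v = e (G.dist u v) := by
  induction p using Polynomial.induction_on with
  | C r =>
    refine ⟨fun n ↦ if n = 0 then r else 0, fun u v ↦ ?_⟩
    rw [aeval_C, Matrix.algebraMap_matrix_apply]
    simp [hG.1.dist_eq_zero_iff]
  | add p q hp hq =>
    obtain ⟨e, he⟩ := hp
    obtain ⟨e', he'⟩ := hq
    exact ⟨fun n ↦ e n + e' n, fun u v ↦ by rw [map_add, Matrix.add_apply, he, he']⟩
  | monomial n r h =>
    obtain ⟨e, he⟩ := h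
    refine ⟨fun i ↦ b 0 * e i + b i * (e (i + 1) - e i) + c i * (e (i - 1) - e i),
      fun u v ↦ ?_⟩
    rw [pow_succ, ← mul_assoc, map_mul, aeval_X, mul_adjMatrix_apply]
    simp only [he]
    exact sum_neighborFinset hG e u v

theorem exists_posSemidef_dist_of_isEigenvalue (hG : IsDistanceRegularWith G b c)
    (hθ : IsEigenvalue G θ) :
    ∃ e : ℕ → ℝ, (Matrix.of fun u v ↦ e (G.dist u v)).PosSemidef ∧ 0 < e 0 ∧
      ∀ u v, ∑ w ∈ G.neighborFinset v, e (G.dist u w) = θ * e (G.dist u v) := by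
  classical
  have hA : (G.adjMatrix ℝ).IsHermitian := G.isSymm_adjMatrix
  obtain ⟨p, hpsd, hne, hmul⟩ := exists_aeval_posSemidef_of_hasEigenvalue hA hθ.hasEigenvalue
  obtain ⟨e, he⟩ := exists_aeval_apply_eq hG p
  have hdiag (v : V) : aeval (G.adjMatrix ℝ) p v v = e 0 := by rw [he, G.dist_self]
  refine ⟨e, (show aeval (G.adjMatrix ℝ) p = .of _ from Matrix.ext he) ▸ hpsd, ?_, fun u v ↦ ?_⟩
  · obtain ⟨x⟩ := hG.1.nonempty
    refine lt_of_le_of_ne (hdiag x ▸ hpsd.diag_nonneg) fun h0 ↦ hne ?_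
    exact hpsd.trace_eq_zero_iff.1 (sum_eq_zero fun v _ ↦ (hdiag v).trans h0.symm)
  · have hentry := congrFun (congrFun hmul u) v
    rw [mul_adjMatrix_apply, Matrix.smul_apply, smul_eq_mul] at hentry
    simpa only [he] using hentry

end Spectral

section LocalGraph

theorem of_one_mul_of_one {W : Type*} [Fintype W] :
    (.of 1 : Matrix W W ℝ) * .of 1 = (Fintype.card W : ℝ) • .of 1 := by
  ext
  simp [Matrix.mul_apply]

theorem posSemidef_sub_smul_of_mul_eq_smul {W : Type*} [Fintype W]
    {M : Matrix W W ℝ} (hM : M.PosSemidef) {r : ℝ}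
    (hr : M * .of 1 = (r * Fintype.card W) • (.of 1 : Matrix W W ℝ)) :
    (M - r • (.of 1 : Matrix W W ℝ)).PosSemidef := by
  classical
  cases isEmpty_or_nonempty W
  · exact (Subsingleton.elim 0 (M - r • .of 1)) ▸ .zero
  have hk : (Fintype.card W : ℝ) ≠ 0 := Nat.cast_ne_zero.2 Fintype.card_ne_zero
  set J : Matrix W W ℝ := .of 1
  set k := (Fintype.card W : ℝ)
  have hJ : J.conjTranspose = J := by
    ext
    simp [J]
  have hJJ : J * J = k • J := of_one_mul_of_one
  have hr' : J * M = (r * k) • J := by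
    rw [← hJ, ← hM.isHermitian.eq, ← Matrix.conjTranspose_mul, hr]
    simp
  have hconj : (1 - k⁻¹ • J) * M * (1 - k⁻¹ • J).conjTranspose = M - r • J := by
    simp only [Matrix.conjTranspose_sub, Matrix.conjTranspose_one, Matrix.conjTranspose_smul, hJ,
      star_trivial, sub_mul, mul_sub, one_mul, mul_one, Matrix.smul_mul, Matrix.mul_smul, hr, hr',
      hJJ, smul_smul]
    match_scalars
    · ring
    · field_simp
      ring
  exact hconj ▸ hM.mul_mul_conjTranspose_same _

theorem posSemidef_adjMatrix_add_smul_one {W : Type*} [Fintype W] [DecidableEq W]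
    {Δ : SimpleGraph W} [DecidableRel Δ.Adj] {a : ℕ} {α β γ m : ℝ} (hreg : Δ.IsRegularOfDegree a)
    (hM : (α • (1 : Matrix W W ℝ) + β • Δ.adjMatrix ℝ + γ • .of 1).PosSemidef) (hα : 0 ≤ α)
    (hβ : 0 < β) (hm : α ≤ m * β) : (Δ.adjMatrix ℝ + m • 1).PosSemidef := by
  cases isEmpty_or_nonempty W
  · exact (Subsingleton.elim 0 (Δ.adjMatrix ℝ + m • 1)) ▸ .zero
  have hk : (Fintype.card W : ℝ) ≠ 0 := Nat.cast_ne_zero.2 Fintype.card_ne_zero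
  set J : Matrix W W ℝ := .of 1
  set k := (Fintype.card W : ℝ) with hkdef
  have hAJ : Δ.adjMatrix ℝ * J = (a : ℝ) • J := by
    ext u v
    simp [J, hreg.degree_eq]
  have hJJ : J * J = k • J := of_one_mul_of_one
  have hJpsd : J.PosSemidef := by
    convert Matrix.posSemidef_vecMulVec_self_star (1 : W → ℝ)
    ext
    simp [J, Matrix.vecMulVec_apply]
  have hproj := posSemidef_sub_smul_of_mul_eq_smul hM (r := (α + β * a) / k + γ) <| by
    rw [add_mul, add_mul, Matrix.smul_mul, Matrix.smul_mul, Matrix.smul_mul, one_mul, hAJ, hJJ,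
      ← hkdef]
    match_scalars
    field_simp
  have hsum := (hproj.add (.smul .one (sub_nonneg.2 hm))).add
    (hJpsd.smul (show 0 ≤ (α + β * a) / k by positivity))
  convert hsum.smul (inv_nonneg.2 hβ.le) using 1
  match_scalars <;> field_simp <;> ring

variable {V : Type*} {G : SimpleGraph V} {b c : ℕ → ℕ} {θ : ℝ} {x y z : V}

theorem dist_eq_two_iff :
    G.dist y z = 2 ↔ y ≠ z ∧ ¬G.Adj y z ∧ (G.commonNeighbors y z).Nonempty := by
  rw [← edist_eq_two_iff, SimpleGraph.dist, ENat.toNat_eq_iff two_ne_zero, Nat.cast_ofNat]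

theorem exists_dist_eq_two (hc : G.Connected) (htop : G ≠ ⊤) : ∃ y z, G.dist y z = 2 := by
  obtain ⟨y, z, hne, hnadj⟩ := ne_top_iff_exists_not_adj.1 htop
  exact exists_dist_eq_of_le hc ⟨y, z, rfl⟩ (hc.one_lt_dist_of_ne_of_not_adj hne hnadj)

theorem ncard_commonNeighbors (hG : IsDistanceRegularWith G b c) (hyz : G.dist y z = 2) :
    (G.commonNeighbors y z).ncard = c 2 := by
  rw [← hyz, ← hG.ncard_nearer]
  congr 1
  ext w
  simp [nearer, hyz, mem_commonNeighbors, and_comm]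

theorem b_one_pos [Finite V] (hG : IsDistanceRegularWith G b c) (hyz : G.dist y z = 2) :
    0 < b 1 := by
  obtain ⟨-, -, x, hyx, hzx⟩ := dist_eq_two_iff.1 hyz
  have hdist : G.dist y x = 1 := dist_eq_one_iff_adj.2 hyx
  rw [← hdist, ← hG.ncard_farther, Set.ncard_pos]
  exact ⟨z, hzx.symm, by rw [hyz, hdist]⟩

theorem dist_eq_two_of_mem_neighborSet {y z : G.neighborSet x} (hne : y ≠ z)
    (hnadj : ¬G.Adj y z) : G.dist (y : V) z = 2 :=
  dist_eq_two_iff.2 ⟨Subtype.coe_ne_coe.2 hne, hnadj, x, y.2.symm, z.2.symm⟩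

theorem hasCliqueCommonNeighbors_induce_neighborSet [Finite V] {μ : ℕ}
    (hμ : ∀ y z, G.dist y z = 2 →
      G.IsClique (G.commonNeighbors y z) ∧ (G.commonNeighbors y z).ncard = μ) (x : V) :
    HasCliqueCommonNeighbors (G.induce (G.neighborSet x)) (μ - 1) where
  isClique y z hne hnadj p hp q hq hpq :=
    (hμ y z (dist_eq_two_of_mem_neighborSet hne hnadj)).1 hp hq (Subtype.coe_ne_coe.2 hpq)
  ncard_eq y z hne hnadj := by
    obtain ⟨hclique, hcard⟩ := hμ y z (dist_eq_two_of_mem_neighborSet hne hnadj)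
    have hx : x ∈ G.commonNeighbors (y : V) z := ⟨y.2.symm, z.2.symm⟩
    rw [← hcard, ← Set.ncard_sdiff_singleton_of_mem hx,
      ← Set.ncard_image_of_injective _ Subtype.val_injective]
    congr 1
    ext w
    constructor
    · rintro ⟨p, hp, rfl⟩
      exact ⟨hp, p.2.ne'⟩
    · rintro ⟨hw, hwx⟩
      exact ⟨⟨w, hclique hx hw (Ne.symm hwx)⟩, hw, rfl⟩

variable [Fintype V] [DecidableRel G.Adj]

theorem isRegularOfDegree_induce_neighborSet (hG : IsDistanceRegularWith G b c) (x : V) :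
    (G.induce (G.neighborSet x)).IsRegularOfDegree (b 0 - b 1 - 1) := fun y ↦ by
  have hxy := dist_eq_one_iff_adj.2 y.2
  have hlocal : (G.induce (G.neighborSet x)).degree y =
      #{w ∈ G.neighborFinset y | G.dist x w = 1} := by
    rw [← card_neighborFinset_eq_degree, ← card_map (Function.Embedding.subtype _)]
    congr 1
    ext w
    simp [dist_eq_one_iff_adj, and_comm]
  have hsum := sum_neighborFinset hG (fun n ↦ if n = 1 then 1 else 0) x y
  rw [sum_boole, ← hlocal, hxy, c_one hG y.2] at hsum
  norm_num at hsum
  have hnat : (G.induce (G.neighborSet x)).degree y + b 1 + 1 = b 0 := by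
    exact_mod_cast (by linarith : ((G.induce (G.neighborSet x)).degree y + b 1 + 1 : ℝ) = b 0)
  omega

theorem cosine_sub_mul_eq (hG : IsDistanceRegularWith G b c) {e : ℕ → ℝ}
    (he : ∀ u v, ∑ w ∈ G.neighborFinset v, e (G.dist u w) = θ * e (G.dist u v))
    (hxy : G.Adj x y) :
    b 0 * e 1 = θ * e 0 ∧ b 1 * (e 1 - e 2) = (θ + 1) * (e 0 - e 1) := by
  have hzero := he x x
  have hone := he x y
  rw [sum_neighborFinset hG, G.dist_self] at hzero
  rw [sum_neighborFinset hG, dist_eq_one_iff_adj.2 hxy, c_one hG hxy] at hone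
  norm_num at hzero hone
  exact ⟨by linarith, by linarith⟩

theorem posSemidef_adjMatrix_induce_neighborSet [DecidableEq V]
    (hG : IsDistanceRegularWith G b c) (hθ : IsEigenvalue G θ) (hlt : θ < b 0) (hb : 0 < b 1)
    {m : ℝ} (hm : (b 1 : ℝ) ≤ (m - 1) * (θ + 1)) (hθ1 : 0 < θ + 1) (x : V) :
    ((G.induce (G.neighborSet x)).adjMatrix ℝ + m • 1).PosSemidef := by
  obtain _ | ⟨y, hxy⟩ := isEmpty_or_nonempty (G.neighborSet x)
  · exact (Subsingleton.elim 0 ((G.induce (G.neighborSet x)).adjMatrix ℝ + m • 1)) ▸ .zero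
  obtain ⟨e, hpsd, he0, he⟩ := exists_posSemidef_dist_of_isEigenvalue hG hθ
  obtain ⟨h01, h12⟩ := cosine_sub_mul_eq hG he hxy
  have hb' : (0 : ℝ) < b 1 := Nat.cast_pos.2 hb
  have he10 : 0 < e 0 - e 1 := by
    by_contra! hle
    have := mul_lt_mul_of_pos_right hlt he0
    have := mul_le_mul_of_nonneg_left (sub_nonpos.1 hle) (Nat.cast_nonneg (α := ℝ) (b 0))
    linarith
  have he21 : 0 < e 1 - e 2 := pos_of_mul_pos_right (h12 ▸ mul_pos hθ1 he10) hb'.le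
  have hratio : e 0 - e 1 ≤ (m - 1) * (e 1 - e 2) := by
    refine le_of_mul_le_mul_left ?_ hb'
    calc b 1 * (e 0 - e 1) ≤ (m - 1) * (θ + 1) * (e 0 - e 1) := by gcongr
      _ = b 1 * ((m - 1) * (e 1 - e 2)) := by linear_combination -(m - 1) * h12
  refine posSemidef_adjMatrix_add_smul_one (α := e 0 - e 2) (β := e 1 - e 2) (γ := e 2)
    (isRegularOfDegree_induce_neighborSet hG x) ?_ (by linarith) he21 (by linarith)
  convert hpsd.submatrix (Subtype.val : G.neighborSet x → V) using 1
  ext u v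
  by_cases huv : u = v
  · simp [huv]
  by_cases hadj : G.Adj u v
  · simp [huv, hadj, dist_eq_one_iff_adj.2 hadj]
  · simp [huv, hadj, dist_eq_two_of_mem_neighborSet huv hadj]

end LocalGraph

theorem valency_le {V : Type*} [Fintype V] {G : SimpleGraph V} {b c : ℕ → ℕ} {θ T : ℝ}
    (hG : IsDistanceRegularWith G b c) (hter : IsTerwilliger G) (hc2 : 2 ≤ c 2)
    (hθ : IsEigenvalue G θ) (hlt : θ < b 0) (hT : 0 < T) (hθT : (b 1 : ℝ) / T - 1 ≤ θ) :
    b 0 ≤ cardBound ⌈1 + T⌉₊ := by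
  classical
  obtain ⟨hc, htop, μ, -, hμ⟩ := hter
  obtain ⟨y, z, hyz⟩ := exists_dist_eq_two hc htop
  have hμc : μ = c 2 := (hμ y z hyz).2.symm.trans (ncard_commonNeighbors hG hyz)
  obtain ⟨hne, hnadj, x, hyx, hzx⟩ := dist_eq_two_iff.1 hyz
  have hb : (0 : ℝ) < b 1 := Nat.cast_pos.2 (b_one_pos hG hyz)
  have hdiv : (b 1 : ℝ) / T ≤ θ + 1 := by linarith
  have hθ1 : 0 < θ + 1 := (div_pos hb hT).trans_le hdiv
  have hpsd := posSemidef_adjMatrix_induce_neighborSet hG hθ hlt (Nat.cast_pos.1 hb)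
    (m := ⌈1 + T⌉₊) (hθ1 := hθ1) (x := x) <| by
      calc (b 1 : ℝ) ≤ T * (θ + 1) := (div_le_iff₀' hT).1 hdiv
        _ ≤ (⌈1 + T⌉₊ - 1) * (θ + 1) := by
          gcongr
          linarith [Nat.le_ceil (1 + T)]
  have hlocal : G.induce (G.neighborSet x) ≠ ⊤ :=
    ne_top_iff_exists_not_adj.2
      ⟨⟨y, hyx.symm⟩, ⟨z, hzx.symm⟩, fun h ↦ hne (congrArg Subtype.val h), hnadj⟩
  have hcard := (hasCliqueCommonNeighbors_induce_neighborSet hμ x).card_le_cardBound (by omega)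
    (isRegularOfDegree_induce_neighborSet hG x) hlocal
    (Nat.one_le_ceil_iff.2 (by linarith)) hpsd
  rwa [card_neighborSet_eq_degree, hG.isRegularOfDegree.degree_eq] at hcard

theorem IsSecondLargestEigenvalue.lt_valency {V : Type*} [Fintype V] {G : SimpleGraph V}
    {b c : ℕ → ℕ} {θ : ℝ} (hθ : IsSecondLargestEigenvalue G θ)
    (hG : IsDistanceRegularWith G b c) : θ < b 0 := by
  classical
  obtain ⟨⟨-, s, hs, hlt⟩, -⟩ := hθ
  exact hlt.trans_le (hs.le_of_isRegularOfDegree hG.isRegularOfDegree)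

end DRG

theorem proposition8 (T : ℝ) (hT : 1 ≤ T) :
    ∃ S : Finset (Σ n : ℕ, SimpleGraph (Fin n)),
      ∀ (V : Type*) [Fintype V] (G : SimpleGraph V) (b c : ℕ → ℕ) (θ : ℝ),
        DRG.IsDistanceRegularWith G b c → DRG.IsTerwilliger G → 2 ≤ c 2 →
        DRG.IsSecondLargestEigenvalue G θ → (b 1 : ℝ) / T - 1 ≤ θ →
        ∃ H ∈ S, Nonempty (G ≃g H.2) := by
  classical
  set F := DRG.cardBound ⌈1 + T⌉₊
  let N := (F + 1) ^ 3 ^ (2 * F + 1)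
  refine ⟨(range (N + 1)).sigma fun _ ↦ univ, fun V _ G b c θ hG hter hc2 hθ hθT ↦ ?_⟩
  have hvalency : b 0 ≤ F :=
    DRG.valency_le hG hter hc2 hθ.1.1 (hθ.lt_valency hG) (by linarith) hθT
  obtain ⟨x⟩ := hG.1.nonempty
  have hcard : Fintype.card V ≤ N :=
    calc Fintype.card V ≤ (b 0 + 1) ^ 3 ^ (2 * b 0 + 1) :=
          DRG.card_le_of_dist_le hG.1 (fun y ↦ (hG.isRegularOfDegree.degree_eq y).le)
            fun y ↦ (DRG.dist_lt_of_two_le_c_two hG hc2 x y).le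
      _ ≤ (F + 1) ^ 3 ^ (2 * F + 1) := by gcongr <;> omega
  exact ⟨⟨Fintype.card V, G.map (Fintype.equivFin V)⟩,
    mem_sigma.2 ⟨mem_range.2 (Nat.lt_succ_of_le hcard), mem_univ _⟩,
    ⟨SimpleGraph.Iso.map (Fintype.equivFin V) G⟩⟩
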